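/- Let $N_1\ge 0$, $N_2\ge 1$, $0\le K_1\le N_1$ and $N_2/2<K_2\le N_2$ be integers, where $K_1\ge 1$ unless $N_1=0$. A quantum secret sharing scheme with parameters $q\ge 2$, $\lambda_0\ge 1$, $\lambda^Y_i,\lambda^Q_j\ge 0$ (integers) encodes a secret $Q_0$ of $\lambda_0$ qudits of dimension $q$, which is maximally entangled with a reference system $R$ of the same size (with $RQ_0$ pure), by a completely positive trace-preserving map applied to $Q_0$ (and the identity on $R$) into a classical-quantum state $$\rho=\sum_{y}p(y)\,|y\rangle\langle y|_{Y_1\cdots Y_{N_1}}\otimes\rho^{(y)}_{RQ_1\cdots Q_{N_2}},$$ where $p$ is a probability distribution, the $\rho^{(y)}$ are density matrices, each classical share $Y_i$ consists of $\lambda^Y_i$ $q$-ary digits, and each quantum share $Q_j$ consists of $\lambda^Q_j$ qudits of dimension $q$. Let the access structure $\mathcal A$ be the twin threshold structure: a set of shares is qualified (belongs to $\mathcal A$) if and only if it contains at least $K_1$ of the $N_1$ classical shares and at least $K_2$ of the $N_2$ quantum shares. With von Neumann entropy $H$ and mutual information $I(A;B)=H(A)+H(B)-H(AB)$ in $q$-ary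 units, the scheme is required to satisfy $I(R;D)_\rho=2H(R)_\rho$ for every $D\in\mathcal A$ (decoding) and $I(R;S)_\rho=0$ for every set of shares $S\notin\mathcal A$ (security). A tuple $(R^Y_1,\dots,R^Y_{N_1},R^Q_1,\dots,R^Q_{N_2})$ of real numbers is achievable if for some $q$ and $\lambda_0$ there is such a scheme with $\lambda^Y_i/\lambda_0\le R^Y_i$ and $\lambda^Q_j/\lambda_0\le R^Q_j$ for all $i,j$. The optimal share rate region $\mathcal R^*$ is the closure of the set of all achievable tuples. Then $$\mathcal R^*=\{(R^Y_1,\dots,R^Y_{N_1},R^Q_1,\dots,R^Q_{N_2}) : R^Y_i\ge 2,\ R^Q_j\ge 1,\ i\in[N_1],\ j\in[N_2]\}.$$ -/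

import Mathlib

namespace QSS

/-! ### Finite-dimensional quantum states and channels

A system with orthonormal basis indexed by a finite type `A` has operators `Matrix A A ℂ`;
the composite of the systems indexed by `A` and `B` is indexed by `A × B`. -/

section Quantum

open scoped ComplexOrder

variable {A B : Type}

/-- Density matrices: positive semidefinite with trace one. -/
def IsDensity [Fintype A] (M : Matrix A A ℂ) : Prop :=
  M.PosSemidef ∧ M.trace = 1

/-- `id_κ ⊗ Φ`, applied to an operator on the composite system `κ × A`. -/
def idTensor (κ : Type) (Φ : Matrix A A ℂ →ₗ[ℂ] Matrix B B ℂ)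
    (M : Matrix (κ × A) (κ × A) ℂ) : Matrix (κ × B) (κ × B) ℂ :=
  Matrix.of fun x y => Φ (Matrix.of fun a a' => M (x.1, a) (y.1, a')) x.2 y.2

/-- Completely positive, trace-preserving maps. -/
def IsCPTP [Fintype A] [Fintype B] (Φ : Matrix A A ℂ →ₗ[ℂ] Matrix B B ℂ) : Prop :=
  (∀ (κ : Type) [Fintype κ] (M : Matrix (κ × A) (κ × A) ℂ),
      M.PosSemidef → (idTensor κ Φ M).PosSemidef) ∧
    ∀ M : Matrix A A ℂ, (Φ M).trace = M.trace

/-- The pure maximally entangled state `|φ⟩⟨φ|` of two copies of a system, where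
`|φ⟩ = |A|^{-1/2} ∑ a, |a⟩|a⟩`. -/
noncomputable def maxEntangled (A : Type) [Fintype A] [DecidableEq A] :
    Matrix (A × A) (A × A) ℂ :=
  Matrix.of fun x y => if x.1 = x.2 ∧ y.1 = y.2 then (Fintype.card A : ℂ)⁻¹ else 0

/-- Partial trace over the second system. -/
def traceSnd [Fintype B] (M : Matrix (A × B) (A × B) ℂ) : Matrix A A ℂ :=
  Matrix.of fun a a' => ∑ b, M (a, b) (a', b)

/-- Partial trace over the first system. -/
def traceFst [Fintype A] (M : Matrix (A × B) (A × B) ℂ) : Matrix B B ℂ :=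
  Matrix.of fun b b' => ∑ a, M (a, b) (a, b')

open Classical in
/-- The von Neumann entropy `-Tr(M log_q M)`, in `q`-ary units, of a density matrix `M`:
the sum of `-x log_q x` over the eigenvalues `x` of `M`. -/
noncomputable def vnEntropy (q : ℕ) [Fintype A] [DecidableEq A] (M : Matrix A A ℂ) : ℝ :=
  if h : M.IsHermitian then (∑ a, Real.negMulLog (h.eigenvalues a)) / Real.log q else 0

/-- The quantum mutual information `I(A; B) = H(A) + H(B) - H(A, B)` in `q`-ary units. -/
noncomputable def mutualInfo (q : ℕ) [Fintype A] [DecidableEq A] [Fintype B] [DecidableEq B]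
    (M : Matrix (A × B) (A × B) ℂ) : ℝ :=
  vnEntropy q (traceSnd M) + vnEntropy q (traceFst M) - vnEntropy q M

end Quantum

/-! ### Quantum secret sharing with classical and quantum shares -/

/-- The shares: `Sum.inl i` is the classical share `Y_i`, `Sum.inr j` the quantum share `Q_j`. -/
abbrev Share (N₁ N₂ : ℕ) : Type := Fin N₁ ⊕ Fin N₂

/-- Basis index of `n` qudits of dimension `q`, and also the alphabet of `n` `q`-ary digits. -/
abbrev Digits (q n : ℕ) : Type := Fin n → Fin q

/-- Joint basis index of all shares, when share `s` has `len s` digits. -/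
abbrev Conf {N₁ N₂ : ℕ} (q : ℕ) (len : Share N₁ N₂ → ℕ) : Type :=
  ∀ s : Share N₁ N₂, Digits q (len s)

/-- Joint basis index of the shares in `D`. -/
abbrev SubConf {N₁ N₂ : ℕ} (q : ℕ) (len : Share N₁ N₂ → ℕ) (D : Finset (Share N₁ N₂)) : Type :=
  ∀ s : {s // s ∈ D}, Digits q (len s)

section States

variable {A : Type} {N₁ N₂ q : ℕ} {len : Share N₁ N₂ → ℕ}

/-- The reduced operator on the reference system and the shares in `D`: the partial trace
over all shares outside `D`. -/
def reduce (M : Matrix (A × Conf q len) (A × Conf q len) ℂ) (D : Finset (Share N₁ N₂)) :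
    Matrix (A × SubConf q len D) (A × SubConf q len D) ℂ :=
  Matrix.of fun x y =>
    ∑ z : (∀ s : {s // s ∉ D}, Digits q (len s)),
      M (x.1, (Equiv.piEquivPiSubtypeProd (· ∈ D) fun s => Digits q (len s)).symm (x.2, z))
        (y.1, (Equiv.piEquivPiSubtypeProd (· ∈ D) fun s => Digits q (len s)).symm (y.2, z))

/-- Classical-quantum states `∑ y, p y |y⟩⟨y| ⊗ σ y`, where `p` is a probability distribution
of the classical shares and `σ y` is a joint density matrix of the reference system and the
quantum shares. -/
def IsClassicalQuantum [Fintype A] (M : Matrix (A × Conf q len) (A × Conf q len) ℂ) : Prop :=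
  ∃ (p : (∀ i : Fin N₁, Digits q (len (Sum.inl i))) → ℝ)
    (σ : (∀ i : Fin N₁, Digits q (len (Sum.inl i))) →
      Matrix (A × ∀ j : Fin N₂, Digits q (len (Sum.inr j)))
        (A × ∀ j : Fin N₂, Digits q (len (Sum.inr j))) ℂ),
    (∀ y, 0 ≤ p y) ∧ ∑ y, p y = 1 ∧ (∀ y, IsDensity (σ y)) ∧
    ∀ (a a' : A) (x x' : Conf q len),
      M (a, x) (a', x') =
        if (fun i => x (Sum.inl i)) = (fun i => x' (Sum.inl i)) then
          (p fun i => x (Sum.inl i) : ℂ) *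
            σ (fun i => x (Sum.inl i))
              (a, fun j => x (Sum.inr j)) (a', fun j => x' (Sum.inr j))
        else 0

end States

/-- An encoder of `l₀` qudits of dimension `q` into shares of `len s` digits each: a CPTP map
from the secret to the shares whose output, jointly with the reference system (which holds the
other half of a maximally entangled state and is left untouched), is a classical-quantum state. -/
structure Encoder (N₁ N₂ q l₀ : ℕ) (len : Share N₁ N₂ → ℕ) where
  enc : Matrix (Digits q l₀) (Digits q l₀) ℂ →ₗ[ℂ] Matrix (Conf q len) (Conf q len) ℂ
  cptp : IsCPTP enc
  classical : IsClassicalQuantum (idTensor (Digits q l₀) enc (maxEntangled (Digits q l₀)))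

namespace Encoder

variable {N₁ N₂ q l₀ : ℕ} {len : Share N₁ N₂ → ℕ}

/-- The joint state `ρ` of the reference system `R` and all shares. -/
noncomputable def state (E : Encoder N₁ N₂ q l₀ len) :
    Matrix (Digits q l₀ × Conf q len) (Digits q l₀ × Conf q len) ℂ :=
  idTensor (Digits q l₀) E.enc (maxEntangled (Digits q l₀))

/-- `H(R)` in the state `ρ`. -/
noncomputable def refEntropy (E : Encoder N₁ N₂ q l₀ len) : ℝ :=
  vnEntropy q (traceSnd E.state)

/-- `I(R; D)` in the state `ρ`. -/
noncomputable def info (E : Encoder N₁ N₂ q l₀ len) (D : Finset (Share N₁ N₂)) : ℝ :=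
  mutualInfo q (reduce E.state D)

/-- The decoding constraint for an access structure (the set of qualified share sets). -/
def Decodes (E : Encoder N₁ N₂ q l₀ len) (𝒜 : Set (Finset (Share N₁ N₂))) : Prop :=
  ∀ D ∈ 𝒜, E.info D = 2 * E.refEntropy

/-- The security constraint: forbidden share sets reveal nothing about the secret. -/
def Secure (E : Encoder N₁ N₂ q l₀ len) (𝒜 : Set (Finset (Share N₁ N₂))) : Prop :=
  ∀ S ∉ 𝒜, E.info S = 0

end Encoder

/-- Achievable share rate tuples, for some qudit dimension `q` and some secret size `l₀`. -/
def Achievable {N₁ N₂ : ℕ} (𝒜 : Set (Finset (Share N₁ N₂))) (R : Share N₁ N₂ → ℝ) : Prop :=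
  ∃ (q l₀ : ℕ) (len : Share N₁ N₂ → ℕ) (E : Encoder N₁ N₂ q l₀ len),
    2 ≤ q ∧ 1 ≤ l₀ ∧ E.Decodes 𝒜 ∧ E.Secure 𝒜 ∧ ∀ s, (len s : ℝ) / (l₀ : ℝ) ≤ R s

/-- The optimal share rate region: the closure of the set of achievable tuples. -/
def optimalRegion {N₁ N₂ : ℕ} (𝒜 : Set (Finset (Share N₁ N₂))) : Set (Share N₁ N₂ → ℝ) :=
  closure {R | Achievable 𝒜 R}

/-- Twin threshold access structure: at least `K₁` classical and at least `K₂` quantum shares. -/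
def twinThreshold (N₁ N₂ K₁ K₂ : ℕ) : Set (Finset (Share N₁ N₂)) :=
  {D | ∃ (DY : Finset (Fin N₁)) (DQ : Finset (Fin N₂)),
    D = DY.disjSum DQ ∧ K₁ ≤ DY.card ∧ K₂ ≤ DQ.card}

end QSS

/-! Converse. Adding a share to a set `D` raises `I(R; D)` by at most twice its length if it is
quantum: `H(D)` grows by at most the length (subadditivity) and `H(RD)` drops by at most the length
(Araki–Lieb). A classical share gains at most its length once, because adding a classical system
cannot lower `H(RD)`. These are `mutualInfo_reduce_le` and `mutualInfo_reduce_le_of_classical`. In a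
set of exactly `K₁` classical and `K₂` quantum shares every share is indispensable, so adding the
last one lifts the information from `0` to `2 l₀`. Hence quantum shares have length at least `l₀`
and classical ones at least `2 l₀`. These inequalities cut out a closed set, so they survive the
closure.

Achievability. The corner point is attained by a single scheme with a large prime `q` and one secret
qudit. Encrypt the secret `s` by a quantum one-time pad with key `(k₀, k₁)`: shift `s` by `k₀` and
multiply by the phase `χ(k₁ s)`, with `χ` an additive character. Shamir polynomials `f₀, f₁` with
`K₁` coefficients and values `k₀, k₁` at `0` give two digits to each classical share; a polynomial
`g` with `K₂` coefficients and `g(0) = s + k₀` gives one qudit to each quantum share. The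
environment holds `f₀, f₁`, which makes the classical shares classical, and the values of `g` at the
`2 K₂ - 1 - N₂` points that are not handed out; majority is what makes this number nonnegative.

The global state is pure, so security of `D` means that `D` is decoupled from `R`, and decoding
means that everything outside `D` is (`exists_encoder_of_code`). Decoupling is read off from
symmetries of the set of triples `(f₀, f₁, g)`. If the traced-out systems determine the triple, it
suffices to move the secret without changing what is kept (`decoupled_of_injective`). With too few
classical shares this determination can fail, and translating `f₁` kills the coherences by a phase
(`decoupled_of_few_classical`). -/

namespace QSS

/-! ### Entropy inequalities for positive semidefinite matrices -/

section SpectralEntropy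

set_option linter.unusedSectionVars false

open scoped ComplexOrder
open Matrix Real

variable {m n : Type} [Fintype m] [DecidableEq m] [Fintype n] [DecidableEq n]

/-- The entropy, in nats, of the spectrum of a matrix: the sum of `-x log x` over the real parts
of the roots of its characteristic polynomial. -/
noncomputable def specEntropy (M : Matrix n n ℂ) : ℝ :=
  (M.charpoly.roots.map fun z => negMulLog z.re).sum

lemma specEntropy_of_charpoly {M : Matrix n n ℂ} (d : m → ℝ)
    (h : M.charpoly = ∏ i, (Polynomial.X - Polynomial.C (d i : ℂ))) :
    specEntropy M = ∑ i, negMulLog (d i) := by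
  unfold specEntropy
  rw [h, Finset.prod_eq_multiset_prod, Polynomial.roots_multiset_prod]
  · simp only [Multiset.bind_map, Polynomial.roots_X_sub_C, Multiset.bind_singleton,
      Multiset.map_map, Function.comp_def, Complex.ofReal_re, Finset.sum_map_val]
  · simp [Polynomial.X_sub_C_ne_zero]

lemma specEntropy_diagonal (d : n → ℝ) :
    specEntropy (diagonal fun i => (d i : ℂ)) = ∑ i, negMulLog (d i) :=
  specEntropy_of_charpoly d (charpoly_diagonal _)

/-- The two characteristic polynomials agree up to powers of `X`, whose roots contribute `-0 log 0 =
0`. Applied to `V * Vᴴ`, this says that the two marginals of a pure state have equal entropy. -/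
lemma specEntropy_mul_comm (A : Matrix m n ℂ) (B : Matrix n m ℂ) :
    specEntropy (A * B) = specEntropy (B * A) := by
  have h := congrArg Polynomial.roots (charpoly_mul_comm' A B)
  rw [Polynomial.roots_mul (mul_ne_zero (pow_ne_zero _ Polynomial.X_ne_zero)
      (charpoly_monic _).ne_zero),
    Polynomial.roots_mul (mul_ne_zero (pow_ne_zero _ Polynomial.X_ne_zero)
      (charpoly_monic _).ne_zero), Polynomial.roots_X_pow, Polynomial.roots_X_pow] at h
  have h' := congrArg (fun s : Multiset ℂ => (s.map fun z => negMulLog z.re).sum) h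
  simpa [specEntropy, Multiset.map_nsmul, Multiset.sum_nsmul] using h'

lemma specEntropy_submatrix_equiv (M : Matrix n n ℂ) (e : m ≃ n) :
    specEntropy (M.submatrix e e) = specEntropy M := by
  have h : M.submatrix e e = Matrix.reindex e.symm e.symm M := by simp [Matrix.reindex_apply]
  rw [specEntropy, specEntropy, h, charpoly_reindex]

lemma _root_.Matrix.PosSemidef.exists_diagonalization {M : Matrix n n ℂ} (hM : M.PosSemidef) :
    ∃ (U : Matrix n n ℂ) (d : n → ℝ), Uᴴ * U = 1 ∧ U * Uᴴ = 1 ∧ (∀ i, 0 ≤ d i) ∧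
      M = U * diagonal (fun i => (d i : ℂ)) * Uᴴ := by
  refine ⟨hM.1.eigenvectorUnitary, hM.1.eigenvalues, ?_, ?_, hM.eigenvalues_nonneg, ?_⟩
  · exact Unitary.coe_star_mul_self _
  · exact Unitary.coe_mul_star_self _
  · conv_lhs => rw [hM.1.spectral_theorem]
    rfl

lemma specEntropy_conj {U : Matrix n n ℂ} (hU : Uᴴ * U = 1) (N : Matrix n n ℂ) :
    specEntropy (U * N * Uᴴ) = specEntropy N := by
  rw [specEntropy_mul_comm, ← mul_assoc, hU, one_mul]

lemma vnEntropy_eq (q : ℕ) {M : Matrix n n ℂ} (hM : M.IsHermitian) :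
    vnEntropy q M = specEntropy M / Real.log q := by
  rw [vnEntropy, dif_pos hM]
  congr 1
  exact (specEntropy_of_charpoly _ hM.charpoly_eq).symm

lemma conj_apply_diag (U : Matrix m n ℂ) (d : n → ℝ) (i : m) :
    (U * diagonal (fun j => (d j : ℂ)) * Uᴴ) i i = ((∑ j, Complex.normSq (U i j) * d j : ℝ) : ℂ) := by
  rw [mul_apply]
  push_cast
  refine Finset.sum_congr rfl fun j _ => ?_
  rw [mul_diagonal, conjTranspose_apply, mul_right_comm]
  congr 1
  exact Complex.mul_conj _

lemma sum_normSq_row {U : Matrix m n ℂ} (hU : U * Uᴴ = 1) (i : m) :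
    ∑ j, Complex.normSq (U i j) = 1 := by
  have h := congrFun (congrFun hU i) i
  rw [mul_apply, one_apply_eq] at h
  have h2 : (∑ j, (Complex.normSq (U i j) : ℂ)) = 1 := by
    rw [← h]
    exact Finset.sum_congr rfl fun j _ => (Complex.mul_conj _).symm
  exact_mod_cast h2

lemma sum_normSq_col {U : Matrix m n ℂ} (hU : Uᴴ * U = 1) (j : n) :
    ∑ i, Complex.normSq (U i j) = 1 := by
  have := sum_normSq_row (U := Uᴴ) (by simpa using hU) j
  simpa [conjTranspose_apply] using this

/-- The entropy increases when a matrix is replaced by its diagonal. -/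
lemma specEntropy_le_diag {M : Matrix n n ℂ} (hM : M.PosSemidef) :
    specEntropy M ≤ ∑ i, negMulLog (M i i).re := by
  obtain ⟨U, d, hU, hU', hd, rfl⟩ := hM.exists_diagonalization
  rw [specEntropy_conj hU, specEntropy_diagonal]
  calc ∑ j, negMulLog (d j) = ∑ i, ∑ j, Complex.normSq (U i j) * negMulLog (d j) := by
        rw [Finset.sum_comm]
        simp_rw [← Finset.sum_mul, sum_normSq_col hU, one_mul]
    _ ≤ _ := by
        refine Finset.sum_le_sum fun i _ => ?_
        rw [conj_apply_diag, Complex.ofReal_re]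
        simpa using concaveOn_negMulLog.le_map_sum (t := Finset.univ)
          (w := fun j => Complex.normSq (U i j)) (p := d)
          (fun j _ => Complex.normSq_nonneg _) (sum_normSq_row hU' i) (fun j _ => hd j)

/-- Jensen with uniform weights. The weights `a` need not sum to one, so that the bound applies to
each block of a diagonal. -/
lemma sum_negMulLog_le [Nonempty n] (a : n → ℝ) (ha : ∀ i, 0 ≤ a i) :
    ∑ i, negMulLog (a i) ≤ negMulLog (∑ i, a i) + (∑ i, a i) * Real.log (Fintype.card n) := by
  have hc : (0 : ℝ) < Fintype.card n := by exact_mod_cast Fintype.card_pos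
  have h := concaveOn_negMulLog.le_map_sum (t := Finset.univ)
    (w := fun _ : n => (Fintype.card n : ℝ)⁻¹) (p := a)
    (fun j _ => by positivity) (by simp [hc.ne']) (fun j _ => ha j)
  simp only [smul_eq_mul, ← Finset.mul_sum] at h
  rw [negMulLog_mul] at h
  have h2 : negMulLog (Fintype.card n : ℝ)⁻¹ = (Fintype.card n : ℝ)⁻¹ * Real.log (Fintype.card n) := by
    simp [negMulLog]
  rw [h2] at h
  have h3 := mul_le_mul_of_nonneg_left h hc.le
  rw [mul_inv_cancel_left₀ hc.ne'] at h3
  refine h3.trans (le_of_eq ?_)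
  field_simp
  ring

lemma traceSnd_posSemidef {M : Matrix (m × n) (m × n) ℂ} (hM : M.PosSemidef) :
    (traceSnd M).PosSemidef := by
  have h : traceSnd M = ∑ k, M.submatrix (fun x => (x, k)) (fun x => (x, k)) := by
    ext x y; simp [traceSnd, Matrix.sum_apply]
  rw [h]
  exact posSemidef_sum _ fun k _ => hM.submatrix _

lemma traceFst_posSemidef {M : Matrix (m × n) (m × n) ℂ} (hM : M.PosSemidef) :
    (traceFst M).PosSemidef := by
  have h : traceFst M = ∑ k, M.submatrix (fun x => (k, x)) (fun x => (k, x)) := by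
    ext x y; simp [traceFst, Matrix.sum_apply]
  rw [h]
  exact posSemidef_sum _ fun k _ => hM.submatrix _

lemma trace_traceSnd (M : Matrix (m × n) (m × n) ℂ) : (traceSnd M).trace = M.trace := by
  simp [traceSnd, trace, Fintype.sum_prod_type]

lemma trace_traceFst (M : Matrix (m × n) (m × n) ℂ) : (traceFst M).trace = M.trace := by
  simp [traceFst, trace, Fintype.sum_prod_type_right]

/-- Subadditivity, with the dimension bound for the entropy of the second system. -/
lemma specEntropy_le_traceSnd_add [Nonempty n] {M : Matrix (m × n) (m × n) ℂ}
    (hM : M.PosSemidef) :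
    specEntropy M ≤ specEntropy (traceSnd M) + M.trace.re * Real.log (Fintype.card n) := by
  obtain ⟨U, d, hU, hU', hd, hX⟩ := (traceSnd_posSemidef hM).exists_diagonalization
  -- `V` is `U ⊗ 1`. In the eigenbasis of the first marginal, the diagonal of `M` splits into blocks
  -- whose sums are the eigenvalues `d x`; dropping the off-diagonal entries only increases the
  -- entropy.
  let V : Matrix (m × n) (m × n) ℂ := of fun a b => if a.2 = b.2 then U a.1 b.1 else 0
  have hV : V * Vᴴ = 1 := by
    ext ⟨x, k⟩ ⟨y, l⟩
    have h := congrFun (congrFun hU' x) y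
    rw [mul_apply] at h
    simp only [mul_apply, conjTranspose_apply, V, of_apply, Fintype.sum_prod_type, apply_ite star,
      star_zero, ite_mul, mul_ite, zero_mul, mul_zero, Finset.sum_ite_eq, Finset.mem_univ, if_true]
    simp only [conjTranspose_apply] at h
    by_cases hkl : k = l
    · subst hkl; simpa [one_apply] using h
    · simp [one_apply, hkl]
  have hV2 : Vᴴ * V = 1 := mul_eq_one_comm.mp hV
  have hN : (Vᴴ * M * V).PosSemidef := hM.conjTranspose_mul_mul_same V
  have hMN : specEntropy M = specEntropy (Vᴴ * M * V) := by
    rw [specEntropy_mul_comm, ← mul_assoc, hV, one_mul]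
  have hdiag : ∀ x, ∑ k, (Vᴴ * M * V) (x, k) (x, k) = d x := by
    intro x
    have h1 : Uᴴ * traceSnd M * U = diagonal fun i => (d i : ℂ) := by
      rw [hX]
      calc _ = (Uᴴ * U) * diagonal (fun i => (d i : ℂ)) * (Uᴴ * U) := by simp only [mul_assoc]
        _ = _ := by simp [hU]
    have h2 := congrFun (congrFun h1 x) x
    rw [diagonal_apply_eq] at h2
    rw [← h2]
    simp only [mul_apply, conjTranspose_apply, V, of_apply, Fintype.sum_prod_type, apply_ite star,
      star_zero, ite_mul, mul_ite, zero_mul, mul_zero, Finset.sum_ite_eq', Finset.mem_univ, if_true,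
      traceSnd, Finset.mul_sum, Finset.sum_mul]
    rw [Finset.sum_comm]
    refine Finset.sum_congr rfl fun a _ => ?_
    rw [Finset.sum_comm]
  have hdr : ∀ x, ∑ k, ((Vᴴ * M * V) (x, k) (x, k)).re = d x := by
    intro x
    have := congrArg Complex.re (hdiag x)
    simpa using this
  have htr : M.trace.re = ∑ x, d x := by
    have : M.trace = (Vᴴ * M * V).trace := by rw [trace_mul_comm, ← mul_assoc, hV, one_mul]
    rw [this, trace, Complex.re_sum, Fintype.sum_prod_type]
    simp [hdr]
  rw [hMN]
  refine (specEntropy_le_diag hN).trans ?_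
  rw [Fintype.sum_prod_type, hX, specEntropy_conj hU, specEntropy_diagonal, htr, Finset.sum_mul,
    ← Finset.sum_add_distrib]
  refine Finset.sum_le_sum fun x _ => ?_
  have h := sum_negMulLog_le (fun k => ((Vᴴ * M * V) (x, k) (x, k)).re)
    fun k => (Complex.le_def.mp hN.diag_nonneg).1
  simpa [hdr] using h

lemma _root_.Matrix.PosSemidef.exists_mul_conjTranspose {M : Matrix n n ℂ} (hM : M.PosSemidef) :
    ∃ V : Matrix n n ℂ, M = V * Vᴴ := by
  obtain ⟨U, d, -, -, hd, rfl⟩ := hM.exists_diagonalization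
  refine ⟨U * diagonal fun i => (√(d i) : ℂ), ?_⟩
  rw [conjTranspose_mul, diagonal_conjTranspose, mul_assoc, mul_assoc, ← mul_assoc (diagonal _),
    diagonal_mul_diagonal]
  congr 3
  ext i
  simp only [Pi.star_apply, RCLike.star_def, Complex.conj_ofReal]
  exact_mod_cast (mul_self_sqrt (hd i)).symm

/-- The Araki–Lieb inequality, with the dimension bound for the entropy of the second system. -/
lemma specEntropy_traceSnd_le_add [Nonempty n] {M : Matrix (m × n) (m × n) ℂ}
    (hM : M.PosSemidef) :
    specEntropy (traceSnd M) ≤ specEntropy M + M.trace.re * Real.log (Fintype.card n) := by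
  obtain ⟨V, rfl⟩ := hM.exists_mul_conjTranspose
  -- The columns of `V` act as a purifying system `E` of the state on `AB`. Regrouping the pure
  -- state as `A` against `EB` gives `H(A) = H(EB) ≤ H(E) + log |B|`, and `H(E) = H(AB)`.
  let W : Matrix m ((m × n) × n) ℂ := of fun x a => V (x, a.2) a.1
  have h1 : traceSnd (V * Vᴴ) = W * Wᴴ := by
    ext x y
    simp only [traceSnd, of_apply, mul_apply, conjTranspose_apply, W,
      Fintype.sum_prod_type (α₁ := m × n)]
    exact Finset.sum_comm
  have h2 : traceSnd (Wᴴ * W) = Vᴴ * V := by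
    ext e e'
    simp only [traceSnd, of_apply, mul_apply, conjTranspose_apply, W, Fintype.sum_prod_type]
    exact Finset.sum_comm
  have h := specEntropy_le_traceSnd_add (posSemidef_conjTranspose_mul_self W)
  rw [h2, specEntropy_mul_comm, ← h1, specEntropy_mul_comm, ← trace_traceSnd, h2,
    trace_mul_comm] at h
  exact h

/-- Discarding a classical system does not increase the entropy. -/
lemma specEntropy_traceSnd_le_of_classical {M : Matrix (m × n) (m × n) ℂ}
    (hM : M.PosSemidef) (hcl : ∀ x y k l, k ≠ l → M (x, k) (y, l) = 0) :
    specEntropy (traceSnd M) ≤ specEntropy M := by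
  have hb : ∀ k, ∃ (U : Matrix m m ℂ) (d : m → ℝ), Uᴴ * U = 1 ∧ U * Uᴴ = 1 ∧ (∀ i, 0 ≤ d i) ∧
      M.submatrix (fun x => (x, k)) (fun x => (x, k)) =
        U * diagonal (fun i => (d i : ℂ)) * Uᴴ :=
    fun k => (hM.submatrix _).exists_diagonalization
  choose U d hU hU' hd hMk using hb
  let A : n → Matrix m m ℂ := fun k => U k * diagonal fun i => (√(d k i) : ℂ)
  have hA : ∀ k, A k * (A k)ᴴ = M.submatrix (fun x => (x, k)) (fun x => (x, k)) := by
    intro k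
    rw [hMk, conjTranspose_mul, diagonal_conjTranspose, mul_assoc, mul_assoc,
      ← mul_assoc (diagonal _), diagonal_mul_diagonal]
    congr 3
    ext i
    simp only [Pi.star_apply, RCLike.star_def, Complex.conj_ofReal]
    exact_mod_cast mul_self_sqrt (hd k i)
  have hA' : ∀ k, (A k)ᴴ * A k = diagonal fun i => (d k i : ℂ) := by
    intro k
    rw [conjTranspose_mul, diagonal_conjTranspose, mul_assoc, ← mul_assoc _ (U k), hU, one_mul,
      diagonal_mul_diagonal]
    congr 1
    ext i
    simp only [Pi.star_apply, RCLike.star_def, Complex.conj_ofReal]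
    exact_mod_cast mul_self_sqrt (hd k i)
  let V : Matrix (m × n) (m × n) ℂ := of fun a b => if a.2 = b.2 then A a.2 a.1 b.1 else 0
  -- The square roots `A k` of the blocks are placed side by side in `W` and block-diagonally in
  -- `V`. Then `Wᴴ * W` has the same diagonal as the diagonal matrix `Vᴴ * V`, so it has at most the
  -- same entropy.
  let W : Matrix m (m × n) ℂ := of fun x b => A b.2 x b.1
  have hV : V * Vᴴ = M := by
    ext ⟨x, k⟩ ⟨y, l⟩
    have h := congrFun (congrFun (hA k) x) y
    simp only [mul_apply, conjTranspose_apply, submatrix_apply] at h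
    simp only [mul_apply, conjTranspose_apply, V, of_apply, Fintype.sum_prod_type, apply_ite star,
      star_zero, ite_mul, mul_ite, zero_mul, mul_zero, Finset.sum_ite_eq, Finset.mem_univ, if_true]
    by_cases hkl : k = l
    · subst hkl; simpa using h
    · simp [hkl, hcl x y k l hkl]
  have hV' : Vᴴ * V = diagonal fun b : m × n => (d b.2 b.1 : ℂ) := by
    ext ⟨x, k⟩ ⟨y, l⟩
    have h := congrFun (congrFun (hA' k) x) y
    simp only [mul_apply, conjTranspose_apply] at h
    simp only [mul_apply, conjTranspose_apply, V, of_apply, Fintype.sum_prod_type, apply_ite star,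
      star_zero, ite_mul, mul_ite, zero_mul, mul_zero, Finset.sum_ite_eq',
      Finset.mem_univ, if_true]
    by_cases hkl : k = l
    · subst hkl; simpa [diagonal_apply] using h
    · simp [hkl, Ne.symm hkl]
  have hW : W * Wᴴ = traceSnd M := by
    ext x y
    simp only [mul_apply, conjTranspose_apply, W, of_apply, Fintype.sum_prod_type_right, traceSnd]
    refine Finset.sum_congr rfl fun k _ => ?_
    have h := congrFun (congrFun (hA k) x) y
    simpa only [mul_apply, conjTranspose_apply, submatrix_apply] using h
  have hW' : ∀ b, (Wᴴ * W) b b = (d b.2 b.1 : ℂ) := by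
    intro b
    have h := congrFun (congrFun (hA' b.2) b.1) b.1
    rw [diagonal_apply_eq] at h
    rw [← h]
    rfl
  rw [← hW, specEntropy_mul_comm, ← hV, specEntropy_mul_comm V, hV', specEntropy_diagonal]
  refine (specEntropy_le_diag (posSemidef_conjTranspose_mul_self W)).trans (le_of_eq ?_)
  simp [hW']

/-- The entropy of the product of a maximally mixed state and a state. -/
lemma specEntropy_mixed_prod [Nonempty m] {N : Matrix n n ℂ} (hN : N.PosSemidef)
    (htr : N.trace = 1) :
    specEntropy (of fun a b : m × n => if a.1 = b.1 then (Fintype.card m : ℂ)⁻¹ * N a.2 b.2 else 0)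
      = Real.log (Fintype.card m) + specEntropy N := by
  have hc : (0 : ℝ) < Fintype.card m := by exact_mod_cast Fintype.card_pos
  obtain ⟨U, d, hU, hU', hd, hD⟩ := hN.exists_diagonalization
  let V : Matrix (m × n) (m × n) ℂ := of fun a b => if a.1 = b.1 then U a.2 b.2 else 0
  have hV : Vᴴ * V = 1 := by
    ext ⟨x, k⟩ ⟨y, l⟩
    have h := congrFun (congrFun hU k) l
    simp only [mul_apply, conjTranspose_apply] at h
    simp only [mul_apply, conjTranspose_apply, V, of_apply, Fintype.sum_prod_type_right,
      apply_ite star, star_zero, ite_mul, mul_ite, zero_mul, mul_zero,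
      Finset.sum_ite_eq', Finset.mem_univ, if_true]
    by_cases hxy : x = y
    · subst hxy; simpa [one_apply] using h
    · simp [one_apply, hxy, Ne.symm hxy]
  have hVN : (of fun a b : m × n => if a.1 = b.1 then (Fintype.card m : ℂ)⁻¹ * N a.2 b.2 else 0)
      = V * diagonal (fun a : m × n => (((Fintype.card m : ℝ)⁻¹ * d a.2 : ℝ) : ℂ)) * Vᴴ := by
    ext ⟨x, k⟩ ⟨y, l⟩
    rw [mul_apply]
    simp only [mul_diagonal, conjTranspose_apply, V, of_apply, Fintype.sum_prod_type_right,
      apply_ite star, star_zero, ite_mul, mul_ite, zero_mul, mul_zero, Finset.sum_ite_eq,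
      Finset.mem_univ, if_true]
    by_cases hxy : x = y
    · subst hxy
      have h := congrFun (congrFun hD k) l
      rw [mul_apply] at h
      simp only [mul_diagonal, conjTranspose_apply] at h
      simp only [if_true, h, Finset.mul_sum]
      refine Finset.sum_congr rfl fun i _ => ?_
      push_cast
      ring
    · simp [hxy]
  have hsum : ∑ i, d i = 1 := by
    rw [hD, trace_mul_comm, ← mul_assoc, hU, one_mul, trace_diagonal] at htr
    exact_mod_cast htr
  rw [hVN, specEntropy_conj hV, specEntropy_diagonal, hD, specEntropy_conj hU,
    specEntropy_diagonal, Fintype.sum_prod_type]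
  simp only [negMulLog_mul, Finset.sum_add_distrib, ← Finset.sum_mul, ← Finset.mul_sum, hsum]
  simp only [negMulLog, log_inv, Finset.sum_const, Finset.card_univ, nsmul_eq_mul]
  field_simp

end SpectralEntropy

/-! ### Reduced states and the information carried by one share -/

section Reduction

open scoped ComplexOrder
open Matrix

set_option linter.unusedSectionVars false

variable {A : Type} [Fintype A] [DecidableEq A] {N₁ N₂ q : ℕ} {len : Share N₁ N₂ → ℕ}

/-- The configuration that agrees with `x` on `D` and with `c` elsewhere. -/
def overwrite {D : Finset (Share N₁ N₂)} (c : Conf q len) (x : SubConf q len D) : Conf q len :=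
  fun s => if h : s ∈ D then x ⟨s, h⟩ else c s

/-- The restriction of a configuration to the shares in `D`. -/
def restrict (D : Finset (Share N₁ N₂)) (c : Conf q len) : SubConf q len D := fun s => c s

/-- Summing over full configurations, rather than over those outside `D`, gives all sets `D` a
common index type, so that partial traces for `D` and `D.erase s` can be compared. -/
lemma reduce_apply (M : Matrix (A × Conf q len) (A × Conf q len) ℂ) (D : Finset (Share N₁ N₂))
    (a a' : A) (x x' : SubConf q len D) :
    reduce M D (a, x) (a', x') =
      ∑ c : Conf q len, if restrict D c = x then M (a, c) (a', overwrite c x') else 0 := by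
  rw [← (Equiv.piEquivPiSubtypeProd (· ∈ D) fun s => Digits q (len s)).symm.sum_comp,
    Fintype.sum_prod_type, Finset.sum_eq_single x]
  · have hr : ∀ z, restrict D ((Equiv.piEquivPiSubtypeProd (· ∈ D)
        fun s => Digits q (len s)).symm (x, z)) = x := by
      intro z; ext s; simp [restrict]
    simp only [hr, if_true, reduce, of_apply]
    refine Finset.sum_congr rfl fun z _ => ?_
    congr 2
    ext s
    by_cases h : s ∈ D <;> simp [overwrite, h]
  · intro y _ hy
    refine Finset.sum_eq_zero fun z _ => if_neg ?_
    contrapose! hy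
    rw [← hy]
    ext s; simp [restrict]
  · simp

lemma traceSnd_reduce (M : Matrix (A × Conf q len) (A × Conf q len) ℂ)
    (D : Finset (Share N₁ N₂)) : traceSnd (reduce M D) = traceSnd M := by
  ext a a'
  simp only [traceSnd, of_apply, reduce]
  rw [← (Equiv.piEquivPiSubtypeProd (· ∈ D) fun s => Digits q (len s)).symm.sum_comp,
    Fintype.sum_prod_type]

lemma reduce_posSemidef {M : Matrix (A × Conf q len) (A × Conf q len) ℂ} (hM : M.PosSemidef)
    (D : Finset (Share N₁ N₂)) : (reduce M D).PosSemidef := by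
  have h : reduce M D = ∑ z : (∀ s : {s // s ∉ D}, Digits q (len s)),
      M.submatrix
        (fun x => (x.1, (Equiv.piEquivPiSubtypeProd (· ∈ D) fun s => Digits q (len s)).symm
          (x.2, z)))
        (fun x => (x.1, (Equiv.piEquivPiSubtypeProd (· ∈ D) fun s => Digits q (len s)).symm
          (x.2, z))) := by
    ext x y; simp [reduce, Matrix.sum_apply]
  rw [h]
  exact posSemidef_sum _ fun k _ => hM.submatrix _

/-- Splitting off the share `s` from the shares in `D`. -/
noncomputable def splitConf {D : Finset (Share N₁ N₂)} {s : Share N₁ N₂} (hs : s ∈ D) :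
    SubConf q len D ≃ SubConf q len (D.erase s) × Digits q (len s) :=
  Equiv.ofBijective (fun x => (fun t => x ⟨t, Finset.mem_of_mem_erase t.2⟩, x ⟨s, hs⟩)) <| by
    constructor
    · intro x y h
      simp only [Prod.mk.injEq] at h
      ext t : 1
      by_cases ht : t.1 = s
      · obtain ⟨t, htD⟩ := t
        subst ht
        exact h.2
      · exact congrFun h.1 ⟨t.1, Finset.mem_erase.mpr ⟨ht, t.2⟩⟩
    · rintro ⟨x, k⟩
      refine ⟨fun t => if h : s = t.1 then h ▸ k else
        x ⟨t.1, Finset.mem_erase.mpr ⟨Ne.symm h, t.2⟩⟩, ?_⟩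
      simp only [Prod.mk.injEq, dite_true, and_true]
      ext t : 1
      have ht : s ≠ t.1 := (Finset.ne_of_mem_erase t.2).symm
      simp [ht]

lemma splitConf_symm_self {D : Finset (Share N₁ N₂)} {s : Share N₁ N₂} (hs : s ∈ D)
    (x : SubConf q len (D.erase s)) (k : Digits q (len s)) :
    (splitConf hs).symm (x, k) ⟨s, hs⟩ = k :=
  congrArg Prod.snd ((splitConf hs).apply_symm_apply (x, k))

lemma splitConf_symm_of_mem {D : Finset (Share N₁ N₂)} {s : Share N₁ N₂} (hs : s ∈ D)
    (x : SubConf q len (D.erase s)) (k : Digits q (len s)) (t : Share N₁ N₂)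
    (ht : t ∈ D.erase s) :
    (splitConf hs).symm (x, k) ⟨t, Finset.mem_of_mem_erase ht⟩ = x ⟨t, ht⟩ :=
  congrFun (congrArg Prod.fst ((splitConf hs).apply_symm_apply (x, k))) ⟨t, ht⟩

lemma reduce_erase (M : Matrix (A × Conf q len) (A × Conf q len) ℂ) {D : Finset (Share N₁ N₂)}
    {s : Share N₁ N₂} (hs : s ∈ D) (a a' : A) (x x' : SubConf q len (D.erase s)) :
    reduce M (D.erase s) (a, x) (a', x') =
      ∑ k, reduce M D (a, (splitConf hs).symm (x, k)) (a', (splitConf hs).symm (x', k)) := by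
  simp only [reduce_apply]
  rw [Finset.sum_comm]
  refine Finset.sum_congr rfl fun c _ => ?_
  have h : ∀ k, restrict D c = (splitConf hs).symm (x, k) ↔
      restrict (D.erase s) c = x ∧ c s = k := by
    intro k
    rw [Equiv.eq_symm_apply]
    exact Prod.mk_inj
  simp only [h]
  by_cases hx : restrict (D.erase s) c = x
  · simp only [hx, true_and, if_true, Finset.sum_ite_eq, Finset.mem_univ]
    congr 2
    ext t : 1
    by_cases hts : t = s
    · subst hts
      simp [overwrite, hs, splitConf_symm_self]
    · by_cases htD : t ∈ D
      · have hte : t ∈ D.erase s := Finset.mem_erase.mpr ⟨hts, htD⟩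
        simp only [overwrite, htD, hte, dite_true]
        exact (splitConf_symm_of_mem hs x' (c s) t hte).symm
      · simp [overwrite, htD]
  · simp [hx]

/-- `splitConf` in the presence of a reference system. -/
noncomputable def splitRefConf (A : Type) {D : Finset (Share N₁ N₂)} {s : Share N₁ N₂}
    (hs : s ∈ D) :
    (A × SubConf q len (D.erase s)) × Digits q (len s) ≃ A × SubConf q len D :=
  (Equiv.prodAssoc _ _ _).trans ((Equiv.refl A).prodCongr (splitConf hs).symm)

lemma traceSnd_submatrix_splitRefConf (M : Matrix (A × Conf q len) (A × Conf q len) ℂ)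
    {D : Finset (Share N₁ N₂)} {s : Share N₁ N₂} (hs : s ∈ D) :
    traceSnd ((reduce M D).submatrix (splitRefConf A hs) (splitRefConf A hs)) =
      reduce M (D.erase s) := by
  ext ⟨a, x⟩ ⟨a', x'⟩
  rw [reduce_erase M hs]
  rfl

lemma traceSnd_traceFst_submatrix_splitConf (M : Matrix (A × Conf q len) (A × Conf q len) ℂ)
    {D : Finset (Share N₁ N₂)} {s : Share N₁ N₂} (hs : s ∈ D) :
    traceSnd ((traceFst (reduce M D)).submatrix (splitConf hs).symm (splitConf hs).symm) =
      traceFst (reduce M (D.erase s)) := by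
  ext x x'
  simp only [traceSnd, traceFst, submatrix_apply, of_apply, reduce_erase M hs]
  exact Finset.sum_comm

lemma reduce_eq_zero_of_classical {M : Matrix (A × Conf q len) (A × Conf q len) ℂ}
    (hM : IsClassicalQuantum M) {D : Finset (Share N₁ N₂)} {i : Fin N₁} (hi : Sum.inl i ∈ D)
    (a a' : A) (x x' : SubConf q len D) (hx : x ⟨Sum.inl i, hi⟩ ≠ x' ⟨Sum.inl i, hi⟩) :
    reduce M D (a, x) (a', x') = 0 := by
  obtain ⟨p, σ, -, -, -, h⟩ := hM
  refine Finset.sum_eq_zero fun z _ => ?_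
  rw [h, if_neg]
  intro he
  have := congrFun he i
  simp only [Equiv.piEquivPiSubtypeProd_symm_apply, hi, dite_true] at this
  exact hx this

lemma log_card_digits (q n : ℕ) :
    Real.log (Fintype.card (Digits q n)) = n * Real.log q := by
  simp [Real.log_pow]

lemma mutualInfo_eq {B : Type} [Fintype B] [DecidableEq B] (q : ℕ)
    {M : Matrix (A × B) (A × B) ℂ} (hM : M.PosSemidef) :
    mutualInfo q M =
      (specEntropy (traceSnd M) + specEntropy (traceFst M) - specEntropy M) / Real.log q := by
  rw [mutualInfo, vnEntropy_eq q (traceSnd_posSemidef hM).1,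
    vnEntropy_eq q (traceFst_posSemidef hM).1, vnEntropy_eq q hM.1]
  ring

/-- The information gained from a quantum share is at most twice its size. -/
lemma mutualInfo_reduce_le {M : Matrix (A × Conf q len) (A × Conf q len) ℂ} (hq : 2 ≤ q)
    (hM : M.PosSemidef) (htr : M.trace = 1) {D : Finset (Share N₁ N₂)} {s : Share N₁ N₂}
    (hs : s ∈ D) :
    mutualInfo q (reduce M D) ≤ mutualInfo q (reduce M (D.erase s)) + 2 * len s := by
  have : Nonempty (Fin q) := ⟨⟨0, by omega⟩⟩
  have hlog : 0 < Real.log q := Real.log_pos (by exact_mod_cast hq)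
  have hD := reduce_posSemidef hM D
  have htD : (reduce M D).trace = 1 := by rw [← trace_traceSnd, traceSnd_reduce, trace_traceSnd, htr]
  have h1 := specEntropy_le_traceSnd_add
    ((traceFst_posSemidef hD).submatrix (splitConf hs).symm)
  have h2 := specEntropy_traceSnd_le_add (hD.submatrix (splitRefConf A hs))
  rw [traceSnd_traceFst_submatrix_splitConf, specEntropy_submatrix_equiv, log_card_digits,
    ← trace_traceSnd, traceSnd_traceFst_submatrix_splitConf, trace_traceFst,
    ← trace_traceSnd, traceSnd_reduce, trace_traceSnd, htr] at h1
  rw [traceSnd_submatrix_splitRefConf, specEntropy_submatrix_equiv, log_card_digits,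
    ← trace_traceSnd, traceSnd_submatrix_splitRefConf,
    ← trace_traceSnd, traceSnd_reduce, trace_traceSnd, htr] at h2
  simp only [Complex.one_re, one_mul] at h1 h2
  rw [mutualInfo_eq q hD, mutualInfo_eq q (reduce_posSemidef hM _), traceSnd_reduce,
    traceSnd_reduce, div_le_iff₀ hlog, add_mul, div_mul_cancel₀ _ hlog.ne']
  linarith

/-- The information gained from a classical share is at most its size. -/
lemma mutualInfo_reduce_le_of_classical {M : Matrix (A × Conf q len) (A × Conf q len) ℂ}
    (hq : 2 ≤ q) (hM : M.PosSemidef) (htr : M.trace = 1) (hcq : IsClassicalQuantum M)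
    {D : Finset (Share N₁ N₂)} {i : Fin N₁} (hi : Sum.inl i ∈ D) :
    mutualInfo q (reduce M D) ≤
      mutualInfo q (reduce M (D.erase (Sum.inl i))) + len (Sum.inl i) := by
  have : Nonempty (Fin q) := ⟨⟨0, by omega⟩⟩
  have hlog : 0 < Real.log q := Real.log_pos (by exact_mod_cast hq)
  have hD := reduce_posSemidef hM D
  have h1 := specEntropy_le_traceSnd_add
    ((traceFst_posSemidef hD).submatrix (splitConf hi).symm)
  have h2 := specEntropy_traceSnd_le_of_classical (hD.submatrix (splitRefConf A hi)) <| by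
    rintro ⟨a, x⟩ ⟨a', x'⟩ k l hkl
    refine reduce_eq_zero_of_classical hcq hi _ _ _ _ ?_
    simpa [splitRefConf, splitConf_symm_self] using hkl
  rw [traceSnd_traceFst_submatrix_splitConf, specEntropy_submatrix_equiv, log_card_digits,
    ← trace_traceSnd, traceSnd_traceFst_submatrix_splitConf, trace_traceFst,
    ← trace_traceSnd, traceSnd_reduce, trace_traceSnd, htr] at h1
  rw [traceSnd_submatrix_splitRefConf, specEntropy_submatrix_equiv] at h2
  simp only [Complex.one_re, one_mul] at h1
  rw [mutualInfo_eq q hD, mutualInfo_eq q (reduce_posSemidef hM _), traceSnd_reduce,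
    traceSnd_reduce, div_le_iff₀ hlog, add_mul, div_mul_cancel₀ _ hlog.ne']
  linarith

lemma maxEntangled_posSemidef (A : Type) [Fintype A] [DecidableEq A] :
    (maxEntangled A).PosSemidef := by
  have h : maxEntangled A = (Fintype.card A : ℂ)⁻¹ •
      vecMulVec (fun x : A × A => if x.1 = x.2 then (1 : ℂ) else 0)
        (star fun x : A × A => if x.1 = x.2 then (1 : ℂ) else 0) := by
    ext x y
    simp only [maxEntangled, of_apply, Matrix.smul_apply, vecMulVec_apply, Pi.star_apply, smul_eq_mul]
    by_cases h1 : x.1 = x.2 <;> by_cases h2 : y.1 = y.2 <;> simp [h1, h2]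
  rw [h]
  exact (posSemidef_vecMulVec_self_star _).smul (by simp)

lemma traceSnd_idTensor_maxEntangled {B : Type} [Fintype B]
    {Φ : Matrix A A ℂ →ₗ[ℂ] Matrix B B ℂ} (hΦ : ∀ M, (Φ M).trace = M.trace) :
    traceSnd (idTensor A Φ (maxEntangled A)) = diagonal fun _ => (Fintype.card A : ℂ)⁻¹ := by
  ext a a'
  have h := hΦ (of fun b b' => maxEntangled A (a, b) (a', b'))
  simp only [trace, diag_apply] at h
  simp only [traceSnd, idTensor, of_apply, h]
  by_cases haa : a = a'
  · subst haa
    simp [maxEntangled]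
  · simp only [maxEntangled, of_apply, diagonal_apply_ne _ haa]
    refine Finset.sum_eq_zero fun b _ => if_neg ?_
    rintro ⟨h1, h2⟩
    exact haa (h1.trans h2.symm)

namespace Encoder

variable {l₀ : ℕ} (E : Encoder N₁ N₂ q l₀ len)

lemma state_posSemidef : E.state.PosSemidef := E.cptp.1 _ _ (maxEntangled_posSemidef _)

lemma traceSnd_state :
    traceSnd E.state = diagonal fun _ => (Fintype.card (Digits q l₀) : ℂ)⁻¹ :=
  traceSnd_idTensor_maxEntangled E.cptp.2

lemma trace_state (hq : 2 ≤ q) : E.state.trace = 1 := by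
  rw [← trace_traceSnd, traceSnd_state, trace_diagonal]
  have : (q : ℂ) ≠ 0 := by exact_mod_cast (by omega : q ≠ 0)
  simp [this]

end Encoder

lemma specEntropy_maxMixed [Nonempty A] :
    specEntropy (diagonal fun _ : A => (Fintype.card A : ℂ)⁻¹) = Real.log (Fintype.card A) := by
  have hc : (0 : ℝ) < Fintype.card A := by exact_mod_cast Fintype.card_pos
  have h := specEntropy_diagonal fun _ : A => (Fintype.card A : ℝ)⁻¹
  push_cast at h
  rw [h]
  simp [Real.negMulLog, hc.ne']

lemma Encoder.refEntropy_eq {l₀ : ℕ} (E : Encoder N₁ N₂ q l₀ len) (hq : 2 ≤ q) :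
    E.refEntropy = l₀ := by
  have : Nonempty (Fin q) := ⟨⟨0, by omega⟩⟩
  have hlog : 0 < Real.log q := Real.log_pos (by exact_mod_cast hq)
  rw [Encoder.refEntropy, vnEntropy_eq q (traceSnd_posSemidef E.state_posSemidef).1,
    E.traceSnd_state, specEntropy_maxMixed, log_card_digits, mul_div_cancel_right₀ _ hlog.ne']

/-! ### The converse bounds -/

lemma mem_twinThreshold_iff {K₁ K₂ : ℕ} {D : Finset (Share N₁ N₂)} :
    D ∈ twinThreshold N₁ N₂ K₁ K₂ ↔ K₁ ≤ D.toLeft.card ∧ K₂ ≤ D.toRight.card := by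
  constructor
  · rintro ⟨DY, DQ, rfl, h1, h2⟩
    simpa using ⟨h1, h2⟩
  · rintro ⟨h1, h2⟩
    exact ⟨_, _, (Finset.toLeft_disjSum_toRight).symm, h1, h2⟩

/-- For every set of `K₁` classical and `K₂` quantum shares, each share is indispensable. -/
lemma erase_notMem_twinThreshold {K₁ K₂ : ℕ} {DY : Finset (Fin N₁)} {DQ : Finset (Fin N₂)}
    (hY : DY.card = K₁) (hQ : DQ.card = K₂) {s : Share N₁ N₂} (hs : s ∈ DY.disjSum DQ) :
    (DY.disjSum DQ).erase s ∉ twinThreshold N₁ N₂ K₁ K₂ := by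
  intro h
  rw [mem_twinThreshold_iff] at h
  have h1 := Finset.card_erase_lt_of_mem hs
  rw [Finset.card_disjSum, hY, hQ, ← Finset.card_toLeft_add_card_toRight] at h1
  omega

lemma Achievable.two_le {K₁ K₂ : ℕ} (hK₁ : K₁ ≤ N₁) (hK₂ : K₂ ≤ N₂) (hpos : 1 ≤ K₁)
    {R : Share N₁ N₂ → ℝ} (h : Achievable (twinThreshold N₁ N₂ K₁ K₂) R) (i : Fin N₁) :
    2 ≤ R (Sum.inl i) := by
  obtain ⟨q, l₀, len, E, hq, hl, hdec, hsec, hR⟩ := h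
  -- A minimal qualified set through the share `i`; its existence needs `1 ≤ K₁`.
  obtain ⟨DY, hiY, -, hY⟩ := Finset.exists_subsuperset_card_eq (Finset.subset_univ {i})
    (by simpa using hpos) (by simpa using hK₁)
  obtain ⟨DQ, -, hQ⟩ := Finset.exists_subset_card_eq (s := (Finset.univ : Finset (Fin N₂)))
    (by simpa using hK₂)
  have hi : Sum.inl i ∈ DY.disjSum DQ := by simpa using hiY
  have h1 := mutualInfo_reduce_le_of_classical hq E.state_posSemidef (E.trace_state hq)
    E.classical hi
  have h2 := hdec _ ⟨DY, DQ, rfl, hY.ge, hQ.ge⟩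
  have h3 := hsec _ (erase_notMem_twinThreshold hY hQ hi)
  rw [E.refEntropy_eq hq] at h2
  have hl' : (0 : ℝ) < l₀ := by exact_mod_cast hl
  refine le_trans ?_ (hR (Sum.inl i))
  rw [le_div_iff₀ hl']
  unfold Encoder.info at h2 h3
  linarith

lemma Achievable.one_le {K₁ K₂ : ℕ} (hK₁ : K₁ ≤ N₁) (hK₂ : K₂ ≤ N₂) (hpos : 1 ≤ K₂)
    {R : Share N₁ N₂ → ℝ} (h : Achievable (twinThreshold N₁ N₂ K₁ K₂) R) (j : Fin N₂) :
    1 ≤ R (Sum.inr j) := by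
  obtain ⟨q, l₀, len, E, hq, hl, hdec, hsec, hR⟩ := h
  obtain ⟨DQ, hjQ, -, hQ⟩ := Finset.exists_subsuperset_card_eq (Finset.subset_univ {j})
    (by simpa using hpos) (by simpa using hK₂)
  obtain ⟨DY, -, hY⟩ := Finset.exists_subset_card_eq (s := (Finset.univ : Finset (Fin N₁)))
    (by simpa using hK₁)
  have hj : Sum.inr j ∈ DY.disjSum DQ := by simpa using hjQ
  have h1 := mutualInfo_reduce_le hq E.state_posSemidef (E.trace_state hq) hj
  have h2 := hdec _ ⟨DY, DQ, rfl, hY.ge, hQ.ge⟩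
  have h3 := hsec _ (erase_notMem_twinThreshold hY hQ hj)
  rw [E.refEntropy_eq hq] at h2
  have hl' : (0 : ℝ) < l₀ := by exact_mod_cast hl
  refine le_trans ?_ (hR (Sum.inr j))
  rw [le_div_iff₀ hl']
  unfold Encoder.info at h2 h3
  linarith

end Reduction

/-! ### Encoders from Kraus operators, and mutual information in the decoupled cases -/

section Kraus

open scoped ComplexOrder
open Matrix

set_option linter.unusedSectionVars false

variable {A B E : Type} [Fintype A] [DecidableEq A] [Fintype B] [DecidableEq B]
  [Fintype E] [DecidableEq E]

/-- The completely positive map with Kraus operators `K e`. -/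
def krausMap (K : E → Matrix B A ℂ) : Matrix A A ℂ →ₗ[ℂ] Matrix B B ℂ where
  toFun M := ∑ e, K e * M * (K e)ᴴ
  map_add' M N := by
    simp [Matrix.mul_add, Matrix.add_mul, Finset.sum_add_distrib]
  map_smul' c M := by simp [Finset.smul_sum]

lemma krausMap_apply_apply (K : E → Matrix B A ℂ) (M : Matrix A A ℂ) (b b' : B) :
    krausMap K M b b' = ∑ e, ∑ a', ∑ a, K e b a * M a a' * star (K e b' a') := by
  simp [krausMap, Matrix.sum_apply, mul_apply, Finset.sum_mul]

lemma krausMap_isCPTP {K : E → Matrix B A ℂ} (hK : ∑ e, (K e)ᴴ * K e = 1) :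
    IsCPTP (krausMap K) := by
  classical
  constructor
  · intro κ _ M hM
    let L : E → Matrix (κ × B) (κ × A) ℂ :=
      fun e => of fun x y => if x.1 = y.1 then K e x.2 y.2 else 0
    have h : idTensor κ (krausMap K) M = ∑ e, L e * M * (L e)ᴴ := by
      ext ⟨k, b⟩ ⟨l, b'⟩
      simp only [idTensor, of_apply, krausMap_apply_apply, Matrix.sum_apply]
      refine Finset.sum_congr rfl fun e _ => ?_
      simp only [mul_apply, conjTranspose_apply, L, of_apply, Fintype.sum_prod_type,
        apply_ite star, star_zero, ite_mul, mul_ite, zero_mul, mul_zero, Finset.sum_mul]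
      rw [Finset.sum_eq_single l (fun l' _ hl => by simp [Ne.symm hl]) (by simp)]
      refine Finset.sum_congr rfl fun a' _ => ?_
      rw [Finset.sum_eq_single k (fun l' _ hl => by simp [Ne.symm hl]) (by simp)]
      simp
    rw [h]
    exact posSemidef_sum _ fun e _ => hM.mul_mul_conjTranspose_same _
  · intro M
    change (∑ e, K e * M * (K e)ᴴ).trace = _
    rw [trace_sum]
    simp_rw [trace_mul_comm _ (K _)ᴴ, ← Matrix.mul_assoc]
    rw [← trace_sum, ← Finset.sum_mul, hK, one_mul]

lemma idTensor_krausMap_maxEntangled (K : E → Matrix B A ℂ) (a a' : A) (b b' : B) :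
    idTensor A (krausMap K) (maxEntangled A) (a, b) (a', b') =
      (Fintype.card A : ℂ)⁻¹ * ∑ e, K e b a * star (K e b' a') := by
  simp only [idTensor, of_apply, krausMap_apply_apply, maxEntangled, Finset.mul_sum]
  refine Finset.sum_congr rfl fun e _ => ?_
  rw [Finset.sum_eq_single a' (fun x _ hx => by simp [Ne.symm hx]) (by simp),
    Finset.sum_eq_single a (fun x _ hx => by simp [Ne.symm hx]) (by simp)]
  simp only [and_self, if_true]
  ring

/-- A state that is block diagonal in the classical shares is classical-quantum. -/
lemma isClassicalQuantum_of_blockDiagonal [Nonempty A] {N₁ N₂ q : ℕ} {len : Share N₁ N₂ → ℕ}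
    (hq : 2 ≤ q) {M : Matrix (A × Conf q len) (A × Conf q len) ℂ} (hM : M.PosSemidef)
    (htr : M.trace = 1)
    (hbl : ∀ a a' x x', (fun i => x (Sum.inl i)) ≠ (fun i => x' (Sum.inl i)) →
      M (a, x) (a', x') = 0) : IsClassicalQuantum M := by
  have : Nonempty (Fin q) := ⟨⟨0, by omega⟩⟩
  let Y := ∀ i : Fin N₁, Digits q (len (Sum.inl i))
  let X := ∀ j : Fin N₂, Digits q (len (Sum.inr j))
  let e : Y × X ≃ Conf q len := (Equiv.sumPiEquivProdPi fun s => Digits q (len s)).symm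
  let N : Y → Matrix (A × X) (A × X) ℂ := fun y =>
    M.submatrix (fun b => (b.1, e (y, b.2))) (fun b => (b.1, e (y, b.2)))
  have hN : ∀ y, (N y).PosSemidef := fun y => hM.submatrix _
  have hNtr : ∀ y, ((N y).trace.re : ℂ) = (N y).trace := fun y =>
    (Complex.eq_re_of_ofReal_le (hN y).trace_nonneg).symm
  have hmix : IsDensity (diagonal fun _ : A × X => (Fintype.card (A × X) : ℂ)⁻¹) := by
    refine ⟨PosSemidef.diagonal fun _ => inv_nonneg.mpr (Nat.cast_nonneg _), ?_⟩
    rw [trace_diagonal, Finset.sum_const, Finset.card_univ, nsmul_eq_mul, mul_inv_cancel₀]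
    exact_mod_cast Fintype.card_ne_zero
  -- A block of trace zero vanishes by positivity, so its normalized state may be any density
  -- matrix; the maximally mixed one is used.
  refine ⟨fun y => (N y).trace.re, fun y => if (N y).trace = 0 then
    diagonal fun _ => (Fintype.card (A × X) : ℂ)⁻¹ else (N y).trace⁻¹ • N y, ?_, ?_, ?_, ?_⟩
  · exact fun y => (Complex.le_def.mp (hN y).trace_nonneg).1
  · have h : ∑ y, (N y).trace = 1 := by
      rw [← htr, trace, Fintype.sum_prod_type]
      simp only [trace, diag_apply, N, submatrix_apply, Fintype.sum_prod_type]
      rw [Finset.sum_comm]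
      refine Finset.sum_congr rfl fun a _ => ?_
      rw [← e.sum_comp, Fintype.sum_prod_type]
    have h' := congrArg Complex.re h
    simpa using h'
  · intro y
    by_cases h0 : (N y).trace = 0
    · simpa only [h0, if_true] using hmix
    · simp only [h0, if_false]
      refine ⟨(hN y).smul (inv_nonneg.mpr (hN y).trace_nonneg), ?_⟩
      rw [trace_smul, smul_eq_mul, inv_mul_cancel₀ h0]
  · intro a a' x x'
    split_ifs with hxx
    · have hx : e (fun i => x (Sum.inl i), fun j => x (Sum.inr j)) = x := e.apply_symm_apply x
      have hx' : e (fun i => x (Sum.inl i), fun j => x' (Sum.inr j)) = x' := by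
        rw [hxx]; exact e.apply_symm_apply x'
      by_cases h0 : (N fun i => x (Sum.inl i)).trace = 0
      · have hz := congrFun (congrFun ((hN _).trace_eq_zero_iff.mp h0)
          (a, fun j => x (Sum.inr j))) (a', fun j => x' (Sum.inr j))
        simp only [N, submatrix_apply, hx, hx', Matrix.zero_apply] at hz
        simp only [h0, hz, Complex.zero_re, Complex.ofReal_zero, zero_mul]
      · simp only [h0, if_false]
        rw [hNtr, Matrix.smul_apply, smul_eq_mul, mul_inv_cancel_left₀ h0]
        simp only [N, submatrix_apply, hx, hx']
    · exact hbl _ _ _ _ hxx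

lemma mutualInfo_eq_zero_of_product [Nonempty A] (q : ℕ) {M : Matrix (A × B) (A × B) ℂ}
    (hM : M.PosSemidef) (htr : M.trace = 1) (h : B → B → ℂ)
    (hMh : ∀ a a' b b', M (a, b) (a', b') = if a = a' then h b b' else 0) :
    mutualInfo q M = 0 := by
  have hc : (Fintype.card A : ℂ) ≠ 0 := by exact_mod_cast Fintype.card_ne_zero
  have hF : ∀ b b', traceFst M b b' = Fintype.card A * h b b' := by
    intro b b'; simp [traceFst, hMh]
  have hFtr : (traceFst M).trace = 1 := by rw [trace_traceFst, htr]
  have h1 : M = of fun x y : A × B => if x.1 = y.1 then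
      (Fintype.card A : ℂ)⁻¹ * traceFst M x.2 y.2 else 0 := by
    ext ⟨a, b⟩ ⟨a', b'⟩
    simp [hMh, hF, hc]
  have h2 : traceSnd M = diagonal fun _ => (Fintype.card A : ℂ)⁻¹ := by
    have hs : ∑ b, h b b = (Fintype.card A : ℂ)⁻¹ := by
      rw [trace] at hFtr
      simp only [diag_apply, hF, ← Finset.mul_sum] at hFtr
      exact eq_inv_of_mul_eq_one_right hFtr
    ext a a'
    by_cases haa : a = a' <;> simp [traceSnd, hMh, haa, hs]
  have h3 := specEntropy_mixed_prod (m := A) (traceFst_posSemidef hM) hFtr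
  rw [← h1] at h3
  rw [mutualInfo_eq q hM, h2, specEntropy_maxMixed, h3]
  simp

/-- `V` is a pure state on `ABE`, and `hV` says that its marginal on `AE` is maximally mixed on `A`
times a state on `E`. Hence `H(B) = H(AE) = log |A| + H(E)` and `H(AB) = H(E)`, so that `I(A; B) = 2
log |A|`. -/
lemma mutualInfo_eq_of_decoupled_environment [Nonempty A] (q : ℕ) (V : Matrix (A × B) E ℂ)
    (htr : (V * Vᴴ).trace = 1) (h : E → E → ℂ)
    (hV : ∀ a a' e e', ∑ b, star (V (a, b) e) * V (a', b) e' = if a = a' then h e e' else 0) :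
    mutualInfo q (V * Vᴴ) = 2 * (Real.log (Fintype.card A) / Real.log q) := by
  have hc : (Fintype.card A : ℂ) ≠ 0 := by exact_mod_cast Fintype.card_ne_zero
  have hM : (V * Vᴴ).PosSemidef := posSemidef_self_mul_conjTranspose V
  have hE : ∀ e e', (Vᴴ * V) e e' = Fintype.card A * h e e' := by
    intro e e'
    rw [mul_apply, Fintype.sum_prod_type]
    simp only [conjTranspose_apply, hV, if_true, Finset.sum_const, Finset.card_univ, nsmul_eq_mul]
  have hEtr : (Vᴴ * V).trace = 1 := by rw [trace_mul_comm, htr]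
  have hsum : ∑ e, h e e = (Fintype.card A : ℂ)⁻¹ := by
    rw [trace] at hEtr
    simp only [diag_apply, hE, ← Finset.mul_sum] at hEtr
    exact eq_inv_of_mul_eq_one_right hEtr
  have h1 : traceSnd (V * Vᴴ) = diagonal fun _ => (Fintype.card A : ℂ)⁻¹ := by
    ext a a'
    simp only [traceSnd, of_apply, mul_apply, conjTranspose_apply]
    rw [Finset.sum_comm]
    simp_rw [mul_comm (V _ _), hV]
    by_cases haa : a = a'
    · simp [haa, hsum]
    · simp [haa, Ne.symm haa]
  let W : Matrix B (A × E) ℂ := of fun b x => V (x.1, b) x.2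
  have h2 : traceFst (V * Vᴴ) = W * Wᴴ := by
    ext b b'
    simp only [traceFst, of_apply, mul_apply, conjTranspose_apply, W, Fintype.sum_prod_type]
  have h3 : Wᴴ * W = of fun x y : A × E => if x.1 = y.1 then
      (Fintype.card A : ℂ)⁻¹ * (Vᴴ * V) x.2 y.2 else 0 := by
    ext ⟨a, e⟩ ⟨a', e'⟩
    rw [mul_apply]
    simp only [conjTranspose_apply, W, of_apply, hV, hE, inv_mul_cancel_left₀ hc]
  have h4 := specEntropy_mixed_prod (m := A) (posSemidef_conjTranspose_mul_self V) hEtr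
  rw [mutualInfo_eq q hM, h1, specEntropy_maxMixed, h2, specEntropy_mul_comm W, h3, h4,
    specEntropy_mul_comm V]
  ring

end Kraus

/-! ### Decoupling from symmetries of a superposition -/

section Decoupling

set_option linter.unusedSectionVars false

variable {Ω R U W : Type} [Fintype Ω] [Fintype R] [DecidableEq R] [Fintype U] [DecidableEq U]
  [Fintype W] [DecidableEq W]

/-- The amplitude at `(r, u, w)` of the superposition of the points `a` with phases `φ a`. -/
def amplitude (ref : Ω → R) (u : Ω → U) (w : Ω → W) (φ : Ω → ℂ) (r : R) (x : U) (z : W) : ℂ :=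
  ∑ a, if ref a = r ∧ u a = x ∧ w a = z then φ a else 0

/-- The overlap obtained by tracing out the third system. -/
def overlap (ref : Ω → R) (u : Ω → U) (w : Ω → W) (φ : Ω → ℂ) (r r' : R) (x x' : U) : ℂ :=
  ∑ z, amplitude ref u w φ r x z * star (amplitude ref u w φ r' x' z)

/-- Tracing out `w` keeps exactly the pairs of points with equal `w`. Permutations of `Ω` act
directly on this double sum. -/
lemma overlap_eq (ref : Ω → R) (u : Ω → U) (w : Ω → W) (φ : Ω → ℂ) (r r' : R) (x x' : U) :
    overlap ref u w φ r r' x x' = ∑ a, ∑ a',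
      if w a = w a' ∧ (ref a = r ∧ u a = x) ∧ ref a' = r' ∧ u a' = x' then φ a * star (φ a')
      else 0 := by
  simp only [overlap, amplitude, star_sum, Finset.sum_mul_sum]
  rw [Finset.sum_comm]
  refine Finset.sum_congr rfl fun a _ => ?_
  rw [Finset.sum_comm]
  refine Finset.sum_congr rfl fun a' _ => ?_
  rw [Finset.sum_eq_single (w a)]
  · by_cases h1 : ref a = r ∧ u a = x
    · by_cases h2 : ref a' = r' ∧ u a' = x'
      · by_cases h3 : w a = w a' <;> simp [h1, h2, h3, eq_comm]
      · simp only [← and_assoc] at h2 ⊢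
        simp [h2, and_assoc]
    · simp only [← and_assoc] at h1 ⊢
      simp [h1, and_assoc]
  · intro z _ hz
    rw [if_neg, zero_mul]
    exact fun h => hz h.2.2.symm
  · simp

/-- Reindexing by `τ`. It serves twice: with `ζ = 1` to carry one reference value to another, and
with `ζ ≠ 1`, `s = r`, `s' = r'` to force an overlap to vanish. -/
lemma overlap_comp_perm (ref : Ω → R) (u : Ω → U) (w : Ω → W) (φ : Ω → ℂ) {r r' s s' : R}
    (x x' : U) (τ : Ω ≃ Ω) (ζ : ℂ) (hu : ∀ a, u (τ a) = u a)
    (hw : ∀ a a', w (τ a) = w (τ a') ↔ w a = w a') (hr : ∀ a, ref (τ a) = s ↔ ref a = r)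
    (hr' : ∀ a, ref (τ a) = s' ↔ ref a = r')
    (hφ : ∀ a a', w a = w a' → ref a = r → ref a' = r' →
      φ (τ a) * star (φ (τ a')) = ζ * (φ a * star (φ a'))) :
    overlap ref u w φ s s' x x' = ζ * overlap ref u w φ r r' x x' := by
  rw [overlap_eq, overlap_eq, ← τ.sum_comp, Finset.mul_sum]
  refine Finset.sum_congr rfl fun a _ => ?_
  rw [← τ.sum_comp, Finset.mul_sum]
  refine Finset.sum_congr rfl fun a' _ => ?_
  simp only [hw, hr, hr', hu]
  split_ifs with h
  · exact hφ _ _ h.1 h.2.1.1 h.2.2.1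
  · simp

/-- The reference system is maximally mixed and uncorrelated with the system `u`. -/
def Decoupled (ref : Ω → R) (u : Ω → U) (w : Ω → W) (φ : Ω → ℂ) : Prop :=
  ∃ h : U → U → ℂ, ∀ r r' x x', overlap ref u w φ r r' x x' = if r = r' then h x x' else 0

lemma decoupled_of_shift [Nonempty R] {ref : Ω → R} {u : Ω → U} {w : Ω → W} {φ : Ω → ℂ}
    (hφ : ∀ a a', w a = w a' → ref a = ref a' → φ a * star (φ a') = 1)
    (hshift : ∀ r r', ∃ τ : Ω ≃ Ω, (∀ a, u (τ a) = u a) ∧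
      (∀ a a', w (τ a) = w (τ a') ↔ w a = w a') ∧ ∀ a, ref (τ a) = r' ↔ ref a = r)
    (hoff : ∀ r r' x x', r ≠ r' → overlap ref u w φ r r' x x' = 0) :
    Decoupled ref u w φ := by
  obtain ⟨r₀⟩ := ‹Nonempty R›
  refine ⟨fun x x' => overlap ref u w φ r₀ r₀ x x', fun r r' x x' => ?_⟩
  split_ifs with hrr
  · subst hrr
    obtain ⟨τ, hu, hw, hr⟩ := hshift r₀ r
    rw [overlap_comp_perm ref u w φ x x' τ 1 hu hw hr hr, one_mul]
    intro a a' haa ha ha'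
    rw [one_mul, hφ a a' haa (ha.trans ha'.symm),
      hφ _ _ ((hw a a').mpr haa) (((hr a).mpr ha).trans ((hr a').mpr ha').symm)]
  · exact hoff r r' x x' hrr

/-- When `w` identifies the point, only the pairs `a = a'` survive the trace, so there are no
coherences between different reference values and the phases cancel. -/
lemma decoupled_of_injective [Nonempty R] {ref : Ω → R} {u : Ω → U} {w : Ω → W} {φ : Ω → ℂ}
    (hw : Function.Injective w) (hφ : ∀ a, φ a * star (φ a) = 1)
    (hshift : ∀ r r', ∃ τ : Ω ≃ Ω, (∀ a, u (τ a) = u a) ∧ ∀ a, ref (τ a) = r' ↔ ref a = r) :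
    Decoupled ref u w φ := by
  refine decoupled_of_shift ?_ ?_ ?_
  · intro a a' h _
    rw [hw h, hφ]
  · intro r r'
    obtain ⟨τ, hu, hr⟩ := hshift r r'
    exact ⟨τ, hu, fun a a' => by rw [hw.eq_iff, hw.eq_iff, τ.injective.eq_iff], hr⟩
  · intro r r' x x' hrr
    rw [overlap_eq]
    refine Finset.sum_eq_zero fun a _ => Finset.sum_eq_zero fun a' _ => if_neg ?_
    rintro ⟨h, ⟨h1, -⟩, h2, -⟩
    exact hrr (h1.symm.trans ((congrArg ref (hw h)).trans h2))

end Decoupling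

/-! ### From a superposition of code words to an encoder -/

section CodeEncoder

open scoped ComplexOrder
open Matrix

/-- The shares of a configuration that do not belong to `D`. -/
def restrictCompl {N₁ N₂ q : ℕ} {len : Share N₁ N₂ → ℕ} (D : Finset (Share N₁ N₂))
    (c : Conf q len) : ∀ s : {s // s ∉ D}, Digits q (len s) := fun s => c s

/-- A superposition of code words with phases `φ`, entangled with a reference system and an
environment that fixes the classical shares, defines an encoder. A set of shares is ignorant of
the secret if it is decoupled from the reference, and can decode if its complement together with
the environment is. -/
lemma exists_encoder_of_code {Ω Env : Type} [Fintype Ω] [Nonempty Ω] [Fintype Env]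
    [DecidableEq Env] {N₁ N₂ q l₀ : ℕ} {len : Share N₁ N₂ → ℕ} (hq : 2 ≤ q)
    (ref : Ω → Digits q l₀) (word : Ω → Conf q len) (env : Ω → Env) (φ : Ω → ℂ)
    (hφ : ∀ a, φ a * star (φ a) = 1) (hinj : Function.Injective fun a => (word a, env a))
    (hshift : ∀ r r', ∃ τ : Ω ≃ Ω, ∀ a, ref (τ a) = r' ↔ ref a = r)
    (hcl : ∀ a a', env a = env a' → ∀ i, word a (Sum.inl i) = word a' (Sum.inl i)) :
    ∃ E : Encoder N₁ N₂ q l₀ len,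
      (∀ D, Decoupled ref (fun a => restrict D (word a))
        (fun a => (restrictCompl D (word a), env a)) φ → E.info D = 0) ∧
      ∀ D, Decoupled ref (fun a => (restrictCompl D (word a), env a))
        (fun a => restrict D (word a)) φ → E.info D = 2 * E.refEntropy := by
  have : Nonempty (Fin q) := ⟨⟨0, by omega⟩⟩
  have hR : (Fintype.card (Digits q l₀) : ℂ) ≠ 0 := by exact_mod_cast Fintype.card_ne_zero
  -- With trivial `u`, decoupling says that the vectors encoding different secrets are orthogonal
  -- and of equal norm. The squared norm is the number `n` of points over one secret, so dividing by
  -- `√n` gives an isometry and hence Kraus operators, indexed by the environment.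
  obtain ⟨h, hh⟩ := decoupled_of_injective (ref := ref) (u := fun _ => ())
    (w := fun a => (word a, env a)) (φ := φ) hinj hφ fun r r' => by
      obtain ⟨τ, hτ⟩ := hshift r r'
      exact ⟨τ, fun _ => rfl, hτ⟩
  obtain ⟨a₀⟩ := ‹Nonempty Ω›
  have hn : h () () = ((Finset.univ.filter fun a => ref a = ref a₀).card : ℂ) := by
    rw [← if_pos (c := ref a₀ = ref a₀) (t := h () ()) (e := 0) rfl, ← hh, overlap_eq,
      Finset.card_filter]
    push_cast
    refine Finset.sum_congr rfl fun a _ => ?_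
    rw [Finset.sum_eq_single a]
    · by_cases ha : ref a = ref a₀ <;> simp only [ha, hφ, and_self, if_true, if_false, and_false,
        false_and]
    · intro b _ hb
      exact if_neg fun hab => hb (hinj hab.1).symm
    · simp
  set n := (Finset.univ.filter fun a => ref a = ref a₀).card with hn_def
  have hn0 : 0 < n := Finset.card_pos.mpr ⟨a₀, by simp⟩
  have hn0' : (n : ℂ) ≠ 0 := by exact_mod_cast hn0.ne'
  let c : ℂ := ((√(n : ℝ))⁻¹ : ℝ)
  have hc : c * star c = (n : ℂ)⁻¹ := by
    simp only [c, RCLike.star_def, Complex.conj_ofReal]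
    rw [← Complex.ofReal_mul, ← mul_inv, Real.mul_self_sqrt (Nat.cast_nonneg n)]
    simp
  let K : Env → Matrix (Conf q len) (Digits q l₀) ℂ :=
    fun e => of fun x r => c * amplitude ref word env φ r x e
  have hK : ∑ e, (K e)ᴴ * K e = 1 := by
    ext r r'
    simp only [Matrix.sum_apply, mul_apply, conjTranspose_apply, K, of_apply]
    rw [Finset.sum_comm, ← Fintype.sum_prod_type']
    have h1 := hh r' r () ()
    rw [hn] at h1
    calc _ = c * star c * overlap ref (fun _ => ()) (fun a => (word a, env a)) φ r' r () () := by
          rw [overlap, Finset.mul_sum]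
          refine Finset.sum_congr rfl fun z _ => ?_
          have h2 : ∀ r, amplitude ref (fun _ => ()) (fun a => (word a, env a)) φ r () z =
              amplitude ref word env φ r z.1 z.2 := by
            intro r
            simp only [amplitude, Prod.ext_iff, true_and]
          rw [h2, h2, star_mul']
          ring
      _ = _ := by
          rw [h1, hc]
          rcases eq_or_ne r r' with rfl | hrr
          · simp [hn0']
          · simp [hrr, hrr.symm]
  have hst : ∀ r r' x x', idTensor _ (krausMap K) (maxEntangled (Digits q l₀)) (r, x) (r', x') =
      (Fintype.card (Digits q l₀) : ℂ)⁻¹ * (n : ℂ)⁻¹ *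
        ∑ e, amplitude ref word env φ r x e * star (amplitude ref word env φ r' x' e) := by
    intro r r' x x'
    rw [idTensor_krausMap_maxEntangled, mul_assoc, ← hc]
    congr 1
    rw [Finset.mul_sum]
    refine Finset.sum_congr rfl fun e _ => ?_
    simp only [K, of_apply, star_mul']
    ring
  have hcptp := krausMap_isCPTP hK
  have hpsd := hcptp.1 _ _ (maxEntangled_posSemidef (Digits q l₀))
  have htr : (idTensor _ (krausMap K) (maxEntangled (Digits q l₀))).trace = 1 := by
    rw [← trace_traceSnd, traceSnd_idTensor_maxEntangled hcptp.2, trace_diagonal, Finset.sum_const,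
      Finset.card_univ, nsmul_eq_mul, mul_inv_cancel₀ hR]
  have hblock : ∀ r r' x x', (fun i => x (Sum.inl i)) ≠ (fun i => x' (Sum.inl i)) →
      idTensor _ (krausMap K) (maxEntangled (Digits q l₀)) (r, x) (r', x') = 0 := by
    intro r r' x x' hx
    rw [hst]
    refine mul_eq_zero_of_right _ (Finset.sum_eq_zero fun e _ => ?_)
    rw [amplitude, amplitude, star_sum, Finset.sum_mul_sum]
    refine Finset.sum_eq_zero fun a _ => Finset.sum_eq_zero fun a' _ => ?_
    by_cases h1 : ref a = r ∧ word a = x ∧ env a = e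
    · rw [if_neg (c := ref a' = r' ∧ word a' = x' ∧ env a' = e), star_zero, mul_zero]
      rintro ⟨-, h2, h3⟩
      refine hx (funext fun i => ?_)
      rw [← h1.2.1, ← h2]
      exact hcl _ _ (h1.2.2.trans h3.symm) i
    · rw [if_neg h1, zero_mul]
  let E : Encoder N₁ N₂ q l₀ len :=
    ⟨krausMap K, hcptp, isClassicalQuantum_of_blockDiagonal hq hpsd htr hblock⟩
  have hword : ∀ (D : Finset (Share N₁ N₂)) a (x : SubConf q len D)
      (z : ∀ s : {s // s ∉ D}, Digits q (len s)),
      word a = (Equiv.piEquivPiSubtypeProd (· ∈ D) fun s => Digits q (len s)).symm (x, z) ↔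
        restrict D (word a) = x ∧ restrictCompl D (word a) = z := by
    intro D a x z
    rw [Equiv.eq_symm_apply]
    exact Prod.mk_inj
  have htrD : ∀ D, (reduce E.state D).trace = 1 := fun D => by
    rw [← trace_traceSnd, traceSnd_reduce, trace_traceSnd, E.trace_state hq]
  refine ⟨E, fun D hD => ?_, fun D hD => ?_⟩
  · obtain ⟨g, hg⟩ := hD
    refine mutualInfo_eq_zero_of_product q (reduce_posSemidef E.state_posSemidef D) (htrD D)
      (fun x x' => (Fintype.card (Digits q l₀) : ℂ)⁻¹ * (n : ℂ)⁻¹ * g x x') fun r r' x x' => ?_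
    have h1 := hg r r' x x'
    rw [overlap, Fintype.sum_prod_type] at h1
    have h2 : ∀ r x z e, amplitude ref (fun a => restrict D (word a))
        (fun a => (restrictCompl D (word a), env a)) φ r x (z, e) = amplitude ref word env φ r
          ((Equiv.piEquivPiSubtypeProd (· ∈ D) fun s => Digits q (len s)).symm (x, z)) e := by
      intro r x z e
      simp only [amplitude, hword, Prod.mk.injEq, and_assoc]
    simp only [h2] at h1
    simp only [reduce, of_apply, Encoder.state, E, hst, ← Finset.mul_sum, h1, mul_ite, mul_zero]
  · obtain ⟨g, hg⟩ := hD
    let b : ℂ := ((√((Fintype.card (Digits q l₀) : ℝ) * n))⁻¹ : ℝ)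
    have hb : b * star b = (Fintype.card (Digits q l₀) : ℂ)⁻¹ * (n : ℂ)⁻¹ := by
      simp only [b, RCLike.star_def, Complex.conj_ofReal]
      rw [← Complex.ofReal_mul, ← mul_inv, Real.mul_self_sqrt (by positivity)]
      simp [mul_comm]
    -- A purification of the reduced state, with the shares outside `D` and the environment as
    -- purifying system.
    let V : Matrix (Digits q l₀ × SubConf q len D)
        ((∀ s : {s // s ∉ D}, Digits q (len s)) × Env) ℂ := of fun y z =>
      b * amplitude ref (fun a => (restrictCompl D (word a), env a))
        (fun a => restrict D (word a)) φ y.1 z y.2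
    have h2 : ∀ r x z e, amplitude ref (fun a => (restrictCompl D (word a), env a))
        (fun a => restrict D (word a)) φ r (z, e) x = amplitude ref word env φ r
          ((Equiv.piEquivPiSubtypeProd (· ∈ D) fun s => Digits q (len s)).symm (x, z)) e := by
      intro r x z e
      simp only [amplitude, hword, Prod.mk.injEq]
      refine Finset.sum_congr rfl fun a _ => if_congr ?_ rfl rfl
      tauto
    have hV : reduce E.state D = V * Vᴴ := by
      ext ⟨r, x⟩ ⟨r', x'⟩
      simp only [reduce, of_apply, Encoder.state, E, hst, mul_apply, conjTranspose_apply, V,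
        Fintype.sum_prod_type, h2, ← hb, Finset.mul_sum, star_mul']
      refine Finset.sum_congr rfl fun z _ => Finset.sum_congr rfl fun e _ => ?_
      ring
    have h3 := htrD D
    rw [hV] at h3
    rw [Encoder.info, hV, mutualInfo_eq_of_decoupled_environment q V h3
      (fun z z' => b * star b * g z' z), E.refEntropy_eq hq, log_card_digits,
      mul_div_cancel_right₀ _ (Real.log_pos (by exact_mod_cast hq)).ne']
    intro r r' z z'
    have h1 := hg r' r z' z
    rw [overlap] at h1
    calc
      _ = b * star b * ∑ x, amplitude ref (fun a => (restrictCompl D (word a), env a))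
          (fun a => restrict D (word a)) φ r' z' x * star (amplitude ref
            (fun a => (restrictCompl D (word a), env a)) (fun a => restrict D (word a))
            φ r z x) := by
          rw [Finset.mul_sum]
          refine Finset.sum_congr rfl fun x _ => ?_
          simp only [V, of_apply, star_mul']
          ring
      _ = _ := by
          rw [h1]
          rcases eq_or_ne r r' with rfl | hrr
          · simp
          · simp [hrr, hrr.symm]

end CodeEncoder

/-! ### Polynomial evaluation codes over a prime field -/

section EvaluationCode

variable {q : ℕ} [Fact q.Prime]

/-- The value at `x` of the polynomial with coefficients `f`. -/
def evalCoeff {K : ℕ} (f : Fin K → ZMod q) (x : ZMod q) : ZMod q := ∑ i, f i * x ^ (i : ℕ)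

lemma evalCoeff_add {K : ℕ} (f g : Fin K → ZMod q) (x : ZMod q) :
    evalCoeff (f + g) x = evalCoeff f x + evalCoeff g x := by
  simp [evalCoeff, add_mul, Finset.sum_add_distrib]

lemma evalCoeff_smul {K : ℕ} (c : ZMod q) (f : Fin K → ZMod q) (x : ZMod q) :
    evalCoeff (c • f) x = c * evalCoeff f x := by
  simp [evalCoeff, mul_assoc, Finset.mul_sum]

lemma natCast_injOn : Set.InjOn (fun n : ℕ => (n : ZMod q)) (Set.Iio q) := by
  intro m hm n hn h
  have := (ZMod.natCast_eq_natCast_iff' m n q).mp h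
  rwa [Nat.mod_eq_of_lt hm, Nat.mod_eq_of_lt hn] at this

/-- Nonvanishing of the Vandermonde determinant: the bound `n < q` keeps the evaluation points
distinct modulo `q`. -/
lemma eq_of_evalCoeff_eq {K : ℕ} {f g : Fin K → ZMod q} {S : Finset ℕ} (hS : ∀ n ∈ S, n < q)
    (hK : K ≤ S.card) (h : ∀ n ∈ S, evalCoeff f n = evalCoeff g n) : f = g := by
  have hmem := fun i => Finset.orderEmbOfCardLe_mem S hK i
  refine sub_eq_zero.mp (Matrix.eq_zero_of_forall_index_sum_pow_mul_eq_zero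
    (f := fun i => ((S.orderEmbOfCardLe hK i : ℕ) : ZMod q)) ?_ fun j => ?_)
  · intro i j hij
    exact (S.orderEmbOfCardLe hK).injective
      (natCast_injOn (hS _ (hmem i)) (hS _ (hmem j)) hij)
  · have := h _ (hmem j)
    simp only [evalCoeff] at this
    simp only [Pi.sub_apply, mul_sub, Finset.sum_sub_distrib, sub_eq_zero]
    simpa only [mul_comm] using this

/-- The polynomial `∏ (X - n)` over `S`, normalized at `0`. It changes the value at `0` without
being seen at the points of `S`, which is the privacy of Shamir sharing. -/
lemma exists_evalCoeff_eq_one {K : ℕ} {S : Finset ℕ} (hS : ∀ n ∈ S, 0 < n ∧ n < q)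
    (hK : S.card < K) :
    ∃ g : Fin K → ZMod q, evalCoeff g 0 = 1 ∧ ∀ n ∈ S, evalCoeff g n = 0 := by
  let P : Polynomial (ZMod q) := ∏ n ∈ S, (Polynomial.X - Polynomial.C (n : ZMod q))
  have hP : P.natDegree < K := by
    rw [Polynomial.natDegree_prod_of_monic _ _ fun n _ => Polynomial.monic_X_sub_C _]
    simpa only [Polynomial.natDegree_X_sub_C, Finset.sum_const, smul_eq_mul, mul_one] using hK
  have hev : ∀ x, evalCoeff (fun i : Fin K => P.coeff i) x = P.eval x := by
    intro x
    rw [Polynomial.eval_eq_sum_range' hP, ← Fin.sum_univ_eq_sum_range fun i => P.coeff i * x ^ i]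
    rfl
  have h0 : P.eval 0 ≠ 0 := by
    rw [Polynomial.eval_prod, Finset.prod_ne_zero_iff]
    intro n hn h
    have h' : ((n : ℕ) : ZMod q) = ((0 : ℕ) : ZMod q) := by simpa using h
    have := natCast_injOn (hS n hn).2 (Fact.out : q.Prime).pos h'
    exact (hS n hn).1.ne' this
  refine ⟨(P.eval 0)⁻¹ • fun i : Fin K => P.coeff i, ?_, fun n hn => ?_⟩
  · rw [evalCoeff_smul, hev, inv_mul_cancel₀ h0]
  · have hPn : P.eval (n : ZMod q) = 0 := by
      rw [Polynomial.eval_prod]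
      exact Finset.prod_eq_zero hn (by rw [Polynomial.eval_sub, Polynomial.eval_X,
        Polynomial.eval_C, sub_self])
    rw [evalCoeff_smul, hev, hPn, mul_zero]

end EvaluationCode

/-! ### The twin threshold scheme -/

section Scheme

/-- Every classical share has two digits and every quantum share one qudit. -/
abbrev shareLen (N₁ N₂ : ℕ) : Share N₁ N₂ → ℕ := Sum.elim (fun _ => 2) (fun _ => 1)

/-- The points of the evaluation code: two polynomials that share the two halves of the key of the
one-time pad among the classical shares, and one polynomial for the quantum shares. -/
abbrev Point (q K₁ K₂ : ℕ) : Type := (Fin 2 → Fin K₁ → ZMod q) × (Fin K₂ → ZMod q)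

variable {N₁ N₂ K₁ K₂ q : ℕ} [Fact q.Prime]

/-- Identification of a digit with a field element. -/
def digitEquiv (q : ℕ) [Fact q.Prime] : Fin q ≃ ZMod q := (ZMod.finEquiv q).toEquiv

/-- The values distributed to the shares. -/
def codeWord (a : Point q K₁ K₂) : Conf q (shareLen N₁ N₂)
  | Sum.inl i => fun d : Fin 2 =>
      (digitEquiv q).symm (evalCoeff (a.1 d) ((i.1 + 1 : ℕ) : ZMod q))
  | Sum.inr j => fun _ : Fin 1 =>
      (digitEquiv q).symm (evalCoeff a.2 ((j.1 + 1 : ℕ) : ZMod q))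

/-- The environment keeps the polynomials of the key and the quantum shares of the threshold
scheme with `2 K₂ - 1` shares that are not distributed. -/
def codeEnv (N₂ : ℕ) (a : Point q K₁ K₂) :
    (Fin 2 → Fin K₁ → ZMod q) × (Fin (2 * K₂ - 1 - N₂) → ZMod q) :=
  (a.1, fun j => evalCoeff a.2 ((N₂ + j.1 + 1 : ℕ) : ZMod q))

/-- The secret, before the one-time pad is applied. -/
def secret (a : Point q K₁ K₂) : ZMod q := evalCoeff a.2 0 - evalCoeff (a.1 0) 0

/-- The secret, as the state of the reference system. -/
def codeRef (a : Point q K₁ K₂) : Digits q 1 := fun _ => (digitEquiv q).symm (secret a)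

/-- The phase from the one-time pad. -/
noncomputable def codePhase (a : Point q K₁ K₂) : ℂ :=
  ZMod.stdAddChar (evalCoeff (a.1 1) 0 * secret a)

lemma codeRef_eq_iff (a : Point q K₁ K₂) (r : Digits q 1) :
    codeRef a = r ↔ secret a = digitEquiv q (r 0) := by
  rw [funext_iff]
  simp [codeRef, Equiv.symm_apply_eq, Fin.forall_fin_one]

lemma codeWord_inl_eq_iff (a b : Point q K₁ K₂) (i : Fin N₁) :
    codeWord (N₂ := N₂) a (Sum.inl i) = codeWord b (Sum.inl i) ↔
      ∀ d, evalCoeff (a.1 d) ((i.1 + 1 : ℕ) : ZMod q) = evalCoeff (b.1 d) ((i.1 + 1 : ℕ) : ZMod q) := by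
  rw [funext_iff]
  exact forall_congr' fun d => (digitEquiv q).symm.injective.eq_iff

lemma codeWord_inr_eq_iff (a b : Point q K₁ K₂) (j : Fin N₂) :
    codeWord (N₁ := N₁) a (Sum.inr j) = codeWord b (Sum.inr j) ↔
      evalCoeff a.2 ((j.1 + 1 : ℕ) : ZMod q) = evalCoeff b.2 ((j.1 + 1 : ℕ) : ZMod q) := by
  rw [funext_iff]
  exact (forall_congr' fun d => (digitEquiv q).symm.injective.eq_iff).trans
    (forall_const (Fin 1))

lemma codeWord_add_eq_iff (a b g : Point q K₁ K₂) (s : Share N₁ N₂) :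
    codeWord (a + g) s = codeWord (b + g) s ↔ codeWord a s = codeWord b s := by
  cases s with
  | inl i =>
    rw [codeWord_inl_eq_iff, codeWord_inl_eq_iff]
    simp [evalCoeff_add]
  | inr j =>
    rw [codeWord_inr_eq_iff, codeWord_inr_eq_iff]
    simp [evalCoeff_add]

lemma codeEnv_add_eq_iff (a b g : Point q K₁ K₂) :
    codeEnv N₂ (a + g) = codeEnv N₂ (b + g) ↔ codeEnv N₂ a = codeEnv N₂ b := by
  simp [codeEnv, evalCoeff_add, funext_iff]

lemma star_stdAddChar (x : ZMod q) :
    star (ZMod.stdAddChar x : ℂ) = ZMod.stdAddChar (-x) := by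
  rw [AddChar.map_neg_eq_conj]; rfl

lemma codePhase_mul_star (a : Point q K₁ K₂) : codePhase a * star (codePhase a) = 1 := by
  rw [codePhase, star_stdAddChar, ← AddChar.map_add_eq_mul, add_neg_cancel,
    AddChar.map_zero_eq_one]

/-- The evaluation points of the classical shares in `D`. -/
def classicalPoints (D : Finset (Share N₁ N₂)) : Finset ℕ := D.toLeft.image fun i => i.1 + 1

/-- The evaluation points of the quantum shares in `D`. -/
def quantumPoints (D : Finset (Share N₁ N₂)) : Finset ℕ := D.toRight.image fun j => j.1 + 1

lemma card_classicalPoints (D : Finset (Share N₁ N₂)) :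
    (classicalPoints D).card = D.toLeft.card :=
  Finset.card_image_of_injective _ fun _ _ h => Fin.ext (Nat.succ_injective h)

lemma card_quantumPoints (D : Finset (Share N₁ N₂)) :
    (quantumPoints D).card = D.toRight.card :=
  Finset.card_image_of_injective _ fun _ _ h => Fin.ext (Nat.succ_injective h)

lemma mem_classicalPoints {D : Finset (Share N₁ N₂)} {n : ℕ} :
    n ∈ classicalPoints D ↔ ∃ i, Sum.inl i ∈ D ∧ i.1 + 1 = n := by
  simp [classicalPoints]

lemma mem_quantumPoints {D : Finset (Share N₁ N₂)} {n : ℕ} :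
    n ∈ quantumPoints D ↔ ∃ j, Sum.inr j ∈ D ∧ j.1 + 1 = n := by
  simp [quantumPoints]

/-- The evaluation points of the quantum shares that are not in `D` or not distributed. -/
def otherPoints (K₂ : ℕ) (D : Finset (Share N₁ N₂)) : Finset ℕ :=
  Finset.Icc 1 (2 * K₂ - 1) \ quantumPoints D

lemma card_otherPoints (h2 : N₂ ≤ 2 * K₂ - 1) (D : Finset (Share N₁ N₂)) :
    (otherPoints K₂ D).card = 2 * K₂ - 1 - D.toRight.card := by
  rw [otherPoints, Finset.card_sdiff_of_subset, card_quantumPoints, Nat.card_Icc,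
    Nat.add_sub_cancel]
  intro n hn
  obtain ⟨j, -, rfl⟩ := mem_quantumPoints.mp hn
  have := j.2
  rw [Finset.mem_Icc]
  omega

lemma restrict_codeWord_eq_iff (D : Finset (Share N₁ N₂)) (a b : Point q K₁ K₂) :
    restrict D (codeWord a) = restrict D (codeWord b) ↔
      (∀ d, ∀ n ∈ classicalPoints D, evalCoeff (a.1 d) n = evalCoeff (b.1 d) n) ∧
        ∀ n ∈ quantumPoints D, evalCoeff a.2 n = evalCoeff b.2 n := by
  have h : restrict D (codeWord a) = restrict D (codeWord b) ↔
      ∀ s ∈ D, codeWord a s = codeWord b s := by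
    rw [funext_iff, Subtype.forall]
    rfl
  rw [h, Sum.forall]
  refine and_congr ⟨fun h d n hn => ?_, fun h i hi => ?_⟩ ⟨fun h n hn => ?_, fun h j hj => ?_⟩
  · obtain ⟨i, hi, rfl⟩ := mem_classicalPoints.mp hn
    exact (codeWord_inl_eq_iff a b i).mp (h i hi) d
  · exact (codeWord_inl_eq_iff a b i).mpr fun d => h d _ (mem_classicalPoints.mpr ⟨i, hi, rfl⟩)
  · obtain ⟨j, hj, rfl⟩ := mem_quantumPoints.mp hn
    exact (codeWord_inr_eq_iff a b j).mp (h j hj)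
  · exact (codeWord_inr_eq_iff a b j).mpr (h _ (mem_quantumPoints.mpr ⟨j, hj, rfl⟩))

/-- The undistributed points `N₂ + 1, …, 2 K₂ - 1` kept by the environment complete the quantum
shares outside `D` to all of `otherPoints K₂ D`. -/
lemma restrictCompl_codeWord_eq_iff (h2 : N₂ ≤ 2 * K₂ - 1) (D : Finset (Share N₁ N₂))
    (a b : Point q K₁ K₂) :
    (restrictCompl D (codeWord a), codeEnv N₂ a) = (restrictCompl D (codeWord b), codeEnv N₂ b) ↔
      a.1 = b.1 ∧ ∀ n ∈ otherPoints K₂ D, evalCoeff a.2 n = evalCoeff b.2 n := by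
  have h : restrictCompl D (codeWord a) = restrictCompl D (codeWord b) ↔
      ∀ s, s ∉ D → codeWord a s = codeWord b s := by
    rw [funext_iff, Subtype.forall]
    rfl
  rw [Prod.mk.injEq, h, codeEnv, codeEnv, Prod.mk.injEq, Sum.forall]
  constructor
  · rintro ⟨⟨-, hQ⟩, h1, ht⟩
    refine ⟨h1, fun n hn => ?_⟩
    rw [otherPoints, Finset.mem_sdiff, Finset.mem_Icc] at hn
    obtain ⟨⟨hn1, hn2⟩, hnD⟩ := hn
    by_cases hnN : n ≤ N₂
    · have hj : (⟨n - 1, by omega⟩ : Fin N₂).1 + 1 = n := Nat.sub_add_cancel hn1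
      have := (codeWord_inr_eq_iff a b _).mp
        (hQ ⟨n - 1, by omega⟩ fun hD => hnD (mem_quantumPoints.mpr ⟨_, hD, hj⟩))
      rwa [hj] at this
    · have hj : N₂ + (n - 1 - N₂) + 1 = n := by omega
      have := congrFun ht ⟨n - 1 - N₂, by omega⟩
      simp only [hj] at this
      exact this
  · rintro ⟨h1, hQ⟩
    refine ⟨⟨fun i _ => (codeWord_inl_eq_iff a b i).mpr fun d => by rw [h1], fun j hj =>
      (codeWord_inr_eq_iff a b j).mpr (hQ _ ?_)⟩, h1, funext fun j => hQ _ ?_⟩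
    · have := j.2
      rw [otherPoints, Finset.mem_sdiff, Finset.mem_Icc, mem_quantumPoints]
      refine ⟨by omega, ?_⟩
      rintro ⟨j', hj', he⟩
      exact hj (by rwa [show j' = j from Fin.ext (Nat.succ_injective he)] at hj')
    · have := j.2
      rw [otherPoints, Finset.mem_sdiff, Finset.mem_Icc, mem_quantumPoints]
      refine ⟨by omega, ?_⟩
      rintro ⟨j', -, he⟩
      have := j'.2
      omega

lemma codeRef_add_iff {g : Point q K₁ K₂} {r r' : Digits q 1}
    (hg : secret g = digitEquiv q (r' 0) - digitEquiv q (r 0)) (a : Point q K₁ K₂) :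
    codeRef (a + g) = r' ↔ codeRef a = r := by
  have h : secret (a + g) = secret a + secret g := by
    simp only [secret, Prod.fst_add, Prod.snd_add, Pi.add_apply, evalCoeff_add]
    ring
  rw [codeRef_eq_iff, codeRef_eq_iff, h, hg]
  constructor <;> intro h
  · linear_combination h
  · linear_combination h

/-- A shift of the secret by a quantum polynomial that vanishes at the points of `S`. -/
lemma exists_quantum_shift {S : Finset ℕ} (hS : ∀ n ∈ S, 0 < n ∧ n < q) (hK : S.card < K₂)
    (r r' : Digits q 1) :
    ∃ g : Fin K₂ → ZMod q, (∀ n ∈ S, evalCoeff g n = 0) ∧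
      ∀ a : Point q K₁ K₂, codeRef (a + (0, g)) = r' ↔ codeRef a = r := by
  obtain ⟨g, hg0, hg⟩ := exists_evalCoeff_eq_one hS hK
  refine ⟨(digitEquiv q (r' 0) - digitEquiv q (r 0)) • g,
    fun n hn => by rw [evalCoeff_smul, hg n hn, mul_zero], codeRef_add_iff ?_⟩
  rw [secret, evalCoeff_smul, hg0]
  simp [evalCoeff]

set_option synthInstance.maxSize 1000
set_option linter.unusedSectionVars false

lemma restrict_codeWord_add_of_vanish {D : Finset (Share N₁ N₂)} {g : Point q K₁ K₂}
    (h1 : ∀ d, ∀ n ∈ classicalPoints D, evalCoeff (g.1 d) n = 0)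
    (h2 : ∀ n ∈ quantumPoints D, evalCoeff g.2 n = 0) (a : Point q K₁ K₂) :
    restrict D (codeWord (a + g)) = restrict D (codeWord a) := by
  rw [restrict_codeWord_eq_iff]
  refine ⟨fun d n hn => ?_, fun n hn => ?_⟩
  · rw [Prod.fst_add, Pi.add_apply, evalCoeff_add, h1 d n hn, add_zero]
  · rw [Prod.snd_add, evalCoeff_add, h2 n hn, add_zero]

lemma evalCoeff_zero {K : ℕ} (x : ZMod q) : evalCoeff (0 : Fin K → ZMod q) x = 0 := by
  simp [evalCoeff]

lemma classicalPoints_lt (hN₁ : N₁ < q) {D : Finset (Share N₁ N₂)} {n : ℕ}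
    (hn : n ∈ classicalPoints D) : 0 < n ∧ n < q := by
  obtain ⟨i, -, rfl⟩ := mem_classicalPoints.mp hn
  have := i.2
  omega

lemma quantumPoints_lt (hN₂ : N₂ < q) {D : Finset (Share N₁ N₂)} {n : ℕ}
    (hn : n ∈ quantumPoints D) : 0 < n ∧ n < q := by
  obtain ⟨i, -, rfl⟩ := mem_quantumPoints.mp hn
  have := i.2
  omega

lemma otherPoints_lt (hK₂ : 2 * K₂ - 1 < q) {D : Finset (Share N₁ N₂)} {n : ℕ}
    (hn : n ∈ otherPoints K₂ D) : 0 < n ∧ n < q := by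
  have := Finset.mem_Icc.mp (Finset.mem_sdiff.mp hn).1
  omega

/-- Of the `2 K₂ - 1` points, at least `K₂` lie outside `D`, which is enough to interpolate the
quantum polynomial. -/
lemma injective_complement (h2 : N₂ ≤ 2 * K₂ - 1) (hK₂ : 2 * K₂ - 1 < q)
    {D : Finset (Share N₁ N₂)} (hD : D.toRight.card < K₂) :
    Function.Injective fun a : Point q K₁ K₂ =>
      (restrictCompl D (codeWord a), codeEnv N₂ a) := by
  intro a b hab
  obtain ⟨h1, hq⟩ := (restrictCompl_codeWord_eq_iff h2 D a b).mp hab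
  refine Prod.ext h1 (eq_of_evalCoeff_eq (fun n hn => (otherPoints_lt hK₂ hn).2) ?_ hq)
  rw [card_otherPoints h2]
  omega

/-- Fewer than `K₂` quantum shares are decoupled from the reference. -/
lemma decoupled_of_few_quantum (h2 : N₂ ≤ 2 * K₂ - 1) (hK₂ : 2 * K₂ - 1 < q)
    {D : Finset (Share N₁ N₂)} (hD : D.toRight.card < K₂) :
    Decoupled (codeRef (K₁ := K₁) (K₂ := K₂) (q := q)) (fun a => restrict D (codeWord a))
      (fun a => (restrictCompl D (codeWord a), codeEnv N₂ a)) codePhase := by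
  have : Nonempty (Fin q) := ⟨⟨0, by omega⟩⟩
  refine decoupled_of_injective (injective_complement h2 hK₂ hD) codePhase_mul_star fun r r' => ?_
  obtain ⟨g, hg, hr⟩ := exists_quantum_shift (K₁ := K₁) (K₂ := K₂) (S := quantumPoints D)
    (fun n hn => quantumPoints_lt (by omega) hn) (by rwa [card_quantumPoints]) r r'
  exact ⟨Equiv.addRight (0, g), restrict_codeWord_add_of_vanish
    (fun d n _ => evalCoeff_zero _) hg, hr⟩

/-- The complement of a qualified set is decoupled from the reference. -/
lemma decoupled_complement_of_qualified (h2 : N₂ ≤ 2 * K₂ - 1) (hK₂ : 2 * K₂ - 1 < q)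
    (hN₁ : N₁ < q) (hpos : 1 ≤ K₂) {D : Finset (Share N₁ N₂)} (hD₁ : K₁ ≤ D.toLeft.card)
    (hD₂ : K₂ ≤ D.toRight.card) :
    Decoupled (codeRef (K₁ := K₁) (K₂ := K₂) (q := q))
      (fun a => (restrictCompl D (codeWord a), codeEnv N₂ a))
      (fun a => restrict D (codeWord a)) codePhase := by
  have : Nonempty (Fin q) := ⟨⟨0, by omega⟩⟩
  refine decoupled_of_injective ?_ codePhase_mul_star fun r r' => ?_
  · intro a b hab
    obtain ⟨h1, hq⟩ := (restrict_codeWord_eq_iff D a b).mp hab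
    refine Prod.ext (funext fun d => eq_of_evalCoeff_eq
      (fun n hn => (classicalPoints_lt hN₁ hn).2) ?_ (h1 d))
      (eq_of_evalCoeff_eq (fun n hn => (quantumPoints_lt (by omega) hn).2) ?_ hq)
    · rwa [card_classicalPoints]
    · rwa [card_quantumPoints]
  -- Since `D` holds at least `K₂` of the `2 K₂ - 1` points, at most `K₂ - 1` remain outside.
  · obtain ⟨g, hg, hr⟩ := exists_quantum_shift (K₁ := K₁) (K₂ := K₂) (S := otherPoints K₂ D)
      (fun n hn => otherPoints_lt hK₂ hn) (by rw [card_otherPoints h2]; omega) r r'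
    refine ⟨Equiv.addRight (0, g), fun a => ?_, hr⟩
    rw [restrictCompl_codeWord_eq_iff h2]
    refine ⟨by simp, fun n hn => ?_⟩
    simp [evalCoeff_add, hg n hn]

lemma translate_complement_eq_iff (D : Finset (Share N₁ N₂)) (a b g : Point q K₁ K₂) :
    (restrictCompl D (codeWord (a + g)), codeEnv N₂ (a + g)) =
        (restrictCompl D (codeWord (b + g)), codeEnv N₂ (b + g)) ↔
      (restrictCompl D (codeWord a), codeEnv N₂ a) =
        (restrictCompl D (codeWord b), codeEnv N₂ b) := by
  simp only [Prod.mk.injEq]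
  rw [codeEnv_add_eq_iff, funext_iff, funext_iff]
  refine and_congr_left fun _ => forall_congr' fun s => ?_
  exact codeWord_add_eq_iff a b g s.1

/-- Fewer than `K₁` classical shares, together with any quantum shares, are decoupled from the
reference. -/
lemma decoupled_of_few_classical (h2 : N₂ ≤ 2 * K₂ - 1) (hN₁ : N₁ < q)
    {D : Finset (Share N₁ N₂)} (hD : D.toLeft.card < K₁) :
    Decoupled (codeRef (K₁ := K₁) (K₂ := K₂) (q := q)) (fun a => restrict D (codeWord a))
      (fun a => (restrictCompl D (codeWord a), codeEnv N₂ a)) codePhase := by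
  have : Nonempty (Fin q) := ⟨⟨0, by omega⟩⟩
  obtain ⟨g, hg0, hg⟩ := exists_evalCoeff_eq_one (q := q) (K := K₁) (S := classicalPoints D)
    (fun n hn => classicalPoints_lt hN₁ hn) (by rwa [card_classicalPoints])
  -- `D` may contain every quantum share, so its complement need not determine the point and
  -- `decoupled_of_injective` does not apply.
  refine decoupled_of_shift ?_ ?_ ?_
  · intro a b hab hr
    have h1 := ((restrictCompl_codeWord_eq_iff h2 D a b).mp hab).1
    have hs : secret a = secret b := by
      have := (codeRef_eq_iff a _).mp hr
      simpa [codeRef] using this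
    have h3 : codePhase b = codePhase a := by rw [codePhase, codePhase, h1, hs]
    rw [h3, codePhase_mul_star]
  · intro r r'
    -- The secret contains the first key polynomial with a minus sign, hence the reversed
    -- difference.
    let γ : Point q K₁ K₂ :=
      (fun d => if d = 0 then (digitEquiv q (r 0) - digitEquiv q (r' 0)) • g else 0, 0)
    have hγ : ∀ d, ∀ n ∈ classicalPoints D, evalCoeff (γ.1 d) n = 0 := fun d n hn => by
      by_cases hd : d = 0
      · simp only [γ, hd, if_true, evalCoeff_smul, hg n hn, mul_zero]
      · simp only [γ, hd, if_false, evalCoeff_zero]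
    have hγs : secret γ = digitEquiv q (r' 0) - digitEquiv q (r 0) := by
      simp only [γ, secret, if_true, evalCoeff_smul, hg0, evalCoeff_zero]
      ring
    exact ⟨Equiv.addRight γ, restrict_codeWord_add_of_vanish hγ (fun n _ => evalCoeff_zero _),
      fun a b => translate_complement_eq_iff D a b _, codeRef_add_iff hγs⟩
  · intro r r' x x' hrr
    -- Adding `g` to the phase key alters neither the shares in `D` nor the secret, but multiplies
    -- the phase by the character of the secret. The overlap of `r` and `r'` is thus multiplied by
    -- the character at their difference.
    let γ : Point q K₁ K₂ := (fun d => if d = 1 then g else 0, 0)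
    have hγ : ∀ d, ∀ n ∈ classicalPoints D, evalCoeff (γ.1 d) n = 0 := fun d n hn => by
      by_cases hd : d = 1
      · simp only [γ, hd, if_true, hg n hn]
      · simp only [γ, hd, if_false, evalCoeff_zero]
    have hγs : secret γ = 0 := by
      simp only [γ, secret, zero_ne_one, if_false, evalCoeff_zero, sub_zero]
    have hphase : ∀ c : Point q K₁ K₂,
        codePhase (c + γ) = codePhase c * ZMod.stdAddChar (secret c) := by
      intro c
      rw [codePhase, codePhase, ← AddChar.map_add_eq_mul]
      congr 1
      simp only [γ, secret, Prod.fst_add, Prod.snd_add, Pi.add_apply, evalCoeff_add, if_true, hg0,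
        evalCoeff_zero, zero_ne_one, if_false]
      ring
    have key := overlap_comp_perm (codeRef (K₁ := K₁) (K₂ := K₂) (q := q))
      (fun a => restrict D (codeWord a)) (fun a => (restrictCompl D (codeWord a), codeEnv N₂ a))
      codePhase (r := r) (r' := r') (s := r) (s' := r') x x' (Equiv.addRight γ)
      (ZMod.stdAddChar (digitEquiv q (r 0) - digitEquiv q (r' 0)))
      (restrict_codeWord_add_of_vanish hγ (fun n _ => evalCoeff_zero _))
      (fun a b => translate_complement_eq_iff D a b _)
      (codeRef_add_iff (hγs.trans (sub_self _).symm))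
      (codeRef_add_iff (hγs.trans (sub_self _).symm)) fun a b _ ha hb => by
        simp only [Equiv.coe_addRight, hphase, star_mul', star_stdAddChar]
        rw [(codeRef_eq_iff a r).mp ha, (codeRef_eq_iff b r').mp hb, sub_eq_add_neg,
          AddChar.map_add_eq_mul]
        ring
    -- The character is injective, so for `r ≠ r'` the factor is not `1`, and an overlap equal to
    -- this multiple of itself is zero.
    have hne : ZMod.stdAddChar (digitEquiv q (r 0) - digitEquiv q (r' 0)) ≠ (1 : ℂ) := by
      rw [← AddChar.map_zero_eq_one (ZMod.stdAddChar (N := q)), ZMod.injective_stdAddChar.ne_iff,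
        sub_ne_zero, (digitEquiv q).injective.ne_iff]
      intro h
      exact hrr (funext fun i => by rw [Subsingleton.elim i 0, h])
    by_contra h0
    exact hne (mul_right_cancel₀ h0 (by rw [one_mul]; exact key.symm))

/-- The combination of a quantum threshold code, a quantum one-time pad, and Shamir's secret
sharing of its key. -/
lemma exists_twinThreshold_encoder (h2 : N₂ ≤ 2 * K₂ - 1) (hK₂ : 2 * K₂ - 1 < q)
    (hN₁ : N₁ < q) (hpos : 1 ≤ K₂) :
    ∃ E : Encoder N₁ N₂ q 1 (shareLen N₁ N₂),
      E.Decodes (twinThreshold N₁ N₂ K₁ K₂) ∧ E.Secure (twinThreshold N₁ N₂ K₁ K₂) := by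
  obtain ⟨E, hsec, hdec⟩ := exists_encoder_of_code (Nat.Prime.two_le Fact.out)
    (codeRef (K₁ := K₁) (K₂ := K₂) (q := q)) (codeWord (N₁ := N₁) (N₂ := N₂)) (codeEnv N₂)
    codePhase codePhase_mul_star
    -- The complement of the empty set consists of all the shares.
    (fun a b hab => injective_complement (N₁ := N₁) (D := ∅) h2 hK₂
        (by rwa [show (∅ : Finset (Share N₁ N₂)).toRight = ∅ from rfl]) <| by
      rw [Prod.mk.injEq] at hab
      exact Prod.ext (congrArg (restrictCompl ∅) hab.1) hab.2)
    (fun r r' => by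
      obtain ⟨g, -, hr⟩ := exists_quantum_shift (K₁ := K₁) (K₂ := K₂) (S := ∅) (by simp)
        hpos r r'
      exact ⟨Equiv.addRight (0, g), hr⟩)
    (fun a b hab i => (codeWord_inl_eq_iff a b i).mpr fun d => by
      rw [show a.1 = b.1 from congrArg (fun e => e.1) hab])
  refine ⟨E, fun D hD => hdec D ?_, fun D hD => hsec D ?_⟩
  · obtain ⟨h1, h3⟩ := mem_twinThreshold_iff.mp hD
    exact decoupled_complement_of_qualified h2 hK₂ hN₁ hpos h1 h3
  · rw [mem_twinThreshold_iff, not_and_or, not_le, not_le] at hD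
    exact hD.elim (decoupled_of_few_classical h2 hN₁) (decoupled_of_few_quantum h2 hK₂)

lemma achievable_of_le (h2 : N₂ < 2 * K₂) {R : Share N₁ N₂ → ℝ}
    (hY : ∀ i, 2 ≤ R (Sum.inl i)) (hQ : ∀ j, 1 ≤ R (Sum.inr j)) :
    Achievable (twinThreshold N₁ N₂ K₁ K₂) R := by
  -- This size makes `0`, the classical points `1, …, N₁` and the quantum points `1, …, 2 K₂ - 1`
  -- distinct modulo `q` within each family.
  obtain ⟨q, hq, hprime⟩ := Nat.exists_infinite_primes (N₁ + 2 * K₂)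
  have : Fact q.Prime := ⟨hprime⟩
  obtain ⟨E, hE⟩ := exists_twinThreshold_encoder (N₁ := N₁) (N₂ := N₂) (K₁ := K₁) (K₂ := K₂)
    (q := q) (by omega) (by omega) (by omega) (by omega)
  refine ⟨q, 1, shareLen N₁ N₂, E, hprime.two_le, le_rfl, hE.1, hE.2, ?_⟩
  rintro (i | j)
  · simpa using hY i
  · simpa using hQ j

end Scheme

end QSS

theorem theorem2 (N₁ N₂ K₁ K₂ : ℕ) (hK₁ : K₁ ≤ N₁) (hK₂ : K₂ ≤ N₂)
    (hmajority : (N₂ : ℝ) / 2 < (K₂ : ℝ)) (hnonredundant : N₁ = 0 ∨ 1 ≤ K₁) :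
    QSS.optimalRegion (QSS.twinThreshold N₁ N₂ K₁ K₂) =
      {R : Fin N₁ ⊕ Fin N₂ → ℝ |
        (∀ i : Fin N₁, 2 ≤ R (Sum.inl i)) ∧ ∀ j : Fin N₂, 1 ≤ R (Sum.inr j)} := by
  have h2 : N₂ < 2 * K₂ := by
    rw [div_lt_iff₀ two_pos] at hmajority
    have : N₂ < K₂ * 2 := by exact_mod_cast hmajority
    omega
  refine subset_antisymm (closure_minimal ?_ ?_) fun R hR =>
    subset_closure (QSS.achievable_of_le h2 hR.1 hR.2)
  · refine fun R hR => ⟨fun i => ?_, fun j => QSS.Achievable.one_le hK₁ hK₂ (by omega) hR j⟩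
    -- The index `i` itself excludes `N₁ = 0`.
    have hpos : 1 ≤ K₁ := hnonredundant.resolve_left fun h => by
      subst h
      exact i.elim0
    exact QSS.Achievable.two_le hK₁ hK₂ hpos hR i
  · simp only [Set.ofPred_and, Set.ofPred_forall]
    exact (isClosed_iInter fun i => isClosed_le continuous_const (continuous_apply _)).inter
      (isClosed_iInter fun j => isClosed_le continuous_const (continuous_apply _))
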